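/- **Conventions.** $|\cdot|$ is the Euclidean norm. A function $\gamma:[0,\infty)\to[0,\infty)$ is of class $\mathcal K$ if it is continuous, strictly increasing and $\gamma(0)=0$; of class $\mathcal K_\infty$ if moreover it is unbounded. $\sigma:[0,\infty)\to[0,\infty)$ is of class $\mathcal L$ if it is continuous, strictly decreasing and tends to $0$ at infinity. $\beta:[0,\infty)^2\to[0,\infty)$ is of class $\mathcal{KL}$ if $\beta(\cdot,s)\in\mathcal K$ for every $s\ge 0$ and $\beta(r,\cdot)\in\mathcal L$ for every $r>0$. **Data.** A plant $\dot x=f(x,u,w)$, $y=g(x,w)$ with $x\in\mathbb R^{n_x}$, $u\in\mathcal U\subseteq\mathbb R^{n_u}$, $w\in\mathcal W\subseteq\mathbb R^{n_w}$, $y\in\mathbb R^{n_y}$, and a steady-state map $p$ with $f(p(u,w),u,w)=0$ for all $u\in\mathcal U$, $w\in\mathcal W$; $h(u,w)=g(p(u,w),w)$; a generalized equation $0\in G(z,s)+\mathcal A(z)$, $s=h(u,w)$, $u=q(z)$, with $G:\mathbb R^{n_z}\times\mathbb R^{n_y}\to\mathbb R^{n_z}$, $\mathcal A:\mathbb R^{n_z}\rightrightarrows\mathbb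 R^{n_z}$, $q:\mathbb R^{n_z}\to\mathcal U$, and its solution set $S(w)=\{z: 0\in G(z,h(q(z),w))+\mathcal A(z)\}$; an algorithm $T:\mathbb R^{n_z}\times\mathbb R^{n_y}\to\mathbb R^{n_z}$ with nominal map $\mathbb T(z,w)=T(z,h(q(z),w))$. A disturbance signal $w$ is *admissible* if it is $C^1$ on $[0,\infty)$ with values in $\mathcal W$ and $\dot w$ is bounded. **Assumption 1.** $f$ is locally Lipschitz, $g$ is globally Lipschitz, $\mathcal W$ and $\mathcal U$ are compact and convex, and there are constants $\epsilon_x,\epsilon_w,\alpha_3,\alpha_4,\alpha_5>0$, a $C^1$ function $V:\mathbb R^{n_x}\times\mathbb R^{n_u}\times\mathbb R^{n_w}\to\mathbb R$ and $\sigma_1\in\mathcal K$ such that $\alpha_3|x-p(u,w)|^2\le V(x,u,w)\le\alpha_4|x-p(u,w)|^2$ for all $x\in\mathbb R^{n_x}$, $u\in\mathcal U$, $w\in\mathcal W$, and such that for every admissible $w$, constant $u\in\mathcal U$, state $x$ and time $t\ge0$ with $V(x,u,w(t))\le\epsilon_x$ and $|\dot w(t)|\le\epsilon_w$ the derivative $\dot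 V$ of $V$ at time $t$ along $\dot x=f(x,u,w(t))$ satisfies $\dot V\le-\alpha_5V(x,u,w(t))+\sigma_1(|\dot w(t)|)$. **Assumption 2.** $q$ is globally Lipschitz, $G$ is $C^1$, and for all $w\in\mathcal W$ and $z\in S(w)$ the map $\Psi=G(\cdot,h(q(\cdot),w))+\mathcal A(\cdot)$ is strongly regular at $(z,0)$, i.e. $0\in\Psi(z)$ and there are neighbourhoods $N$ of $z$ and $M$ of $0$ such that $v\mapsto\Psi^{-1}(v)\cap N$ is a single-valued Lipschitz function on $M$. **Assumption 3.** (i) For all $w\in\mathcal W$: $z=\mathbb T(z,w)$ if and only if $z\in S(w)$. (ii) There are a continuous $W:\mathbb R^{n_z}\times\mathcal W\to\mathbb R$, $\epsilon>0$, $\alpha_1,\alpha_2\in\mathcal K_\infty$ and $\alpha\in\mathcal K$ such that for all $w\in\mathcal W$, $\bar z\in S(w)$ and $|z-\bar z|\le\epsilon$: $\alpha_1(|z-\bar z|)\le W(z,w)\le\alpha_2(|z-\bar z|)$ and $W(\mathbb T(z,w),w)\le W(z,w)-\alpha(|z-\bar z|)$; moreover there is $\delta>0$ such that $|\mathbb T(z,w)-\bar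 z|\le\epsilon$ whenever $w\in\mathcal W$, $\bar z\in S(w)$ and $|z-\bar z|\le\delta$. (iii) For every bounded set $B\subset\mathbb R^{n_z}$ there is $L_T>0$ with $|T(z,s)-T(z,s')|\le L_T|s-s'|$ for all $z\in B$ and all $s,s'$. **The sampled system.** Let $\tau>0$, $t^k=k\tau$, $w^k=w(t^k)$, and let $\psi^k(\xi,v,w)$ be the value at time $t^{k+1}$ of the solution of $\dot\xi(t)=f(\xi(t),v,w(t))$, $\xi(t^k)=\xi$. Put $d^k=\operatorname{ess\,sup}_{t\in[t^k,t^{k+1}]}|\dot w(t)|$ and $\|d\|=\sup_kd^k$. The *plant subsystem* is $x^{k+1}=\psi^k(x^k,u^k,w)$ with an arbitrary input sequence $u^k\in\mathcal U$; put $\|\Delta u\|=\sup_k|u^{k+1}-u^k|$. The *algorithm subsystem* is $z^{k+1}=T(z^k,g(\psi^k(x^k,q(z^k),w),w^{k+1}))$ with an arbitrary sequence $x^k$ (equivalently $\delta x^k=x^k-p(q(z^k),w^k)$) as input. The *closed loop* is $x^{k+1}=\psi^k(x^k,q(z^k),w)$, $z^{k+1}=T(z^k,g(x^{k+1},w^{k+1}))$.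 A *branch* is a continuous map $\bar z:\mathcal W\to\mathbb R^{n_z}$ with $\bar z(w)\in S(w)$ for all $w\in\mathcal W$. The errors are $\delta x^k=x^k-p(q(z^k),w^k)$ and $e^k=z^k-\bar z(w^k)$. **Gains.** *Plant-LISS gains* at $\tau$ are $\beta_x\in\mathcal{KL}$, $\gamma_x^u\in\mathcal L$, $\gamma_x^d\in\mathcal{KL}$, $\pi_1>0$, $\pi_2\in\mathcal K$ such that, with $V^k=V(x^k,u^k,w^k)$, every trajectory of the plant subsystem with admissible $w$ and with $V^0\le0.25\,\epsilon_x$, $\|\Delta u\|\le\pi_1\epsilon_x$, $\pi_2(\|d\|)\le\epsilon_x$, $\|d\|\le\epsilon_w$ satisfies for all $k$ $$V^k\le\beta_x(V^0,k\tau)+\gamma_x^u(\tau)\|\Delta u\|+\gamma_x^d(\|d\|,\tau).$$ *Algorithm-LIOS gains* at $\tau$ for the branch $\bar z$ are $\bar\varepsilon_1,\bar\varepsilon_2,\bar\varepsilon_3>0$, $\beta_z,\beta_u,\gamma_z^x,\gamma_u^x\in\mathcal{KL}$, $\gamma_z^d,\gamma_u^d\in\mathcal K$ such that, with $W^k=W(z^k,w^k)$,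 $u^k=q(z^k)$, $\Delta u^k=u^{k+1}-u^k$ and $\|V\|=\sup_kV(x^k,u^k,w^k)$, every trajectory of the algorithm subsystem with admissible $w$ and with $|e^0|\le\epsilon$, $W^0\le\bar\varepsilon_1$, $\|V\|\le\bar\varepsilon_2$, $\|d\|\le\bar\varepsilon_3$ satisfies for all $k$ $$W^k\le\beta_z(W^0,k)+\gamma_z^x(\|V\|,\tau)+\gamma_z^d(\|d\|),\qquad|\Delta u^k|\le\beta_u(W^0,k)+\gamma_u^x(\|V\|,\tau)+\gamma_u^d(\|d\|).$$ **Theorem.** Let Assumptions 1–3 hold, let $\bar z$ be a branch and $\tau>0$. Then plant-LISS gains and algorithm-LIOS gains at $\tau$ exist. Moreover, for every choice of such gains, with $\tilde\epsilon=\min\{0.25\,\epsilon_x,\bar\varepsilon_2\}$: if $$\gamma_x^u(\tau)\,\gamma_u^x(s,\tau)<s\qquad\text{for all }s\in(0,\tilde\epsilon],$$ then the discrete-time error interconnection is LISS with respect to $d$, i.e. there are $\varepsilon>0$, $\beta\in\mathcal{KL}$ and $\gamma\in\mathcal K$ such that for every admissible $w$ with $\|d\|\le\varepsilon$ and all initial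 data with $|(\delta x^0,e^0)|\le\varepsilon$ the closed loop has a solution for all $k\ge0$, and every such solution satisfies $$|(\delta x^k,e^k)|\le\beta(|(\delta x^0,e^0)|,k)+\gamma(\|d\|)\qquad\text{for all }k\ge0 .$$ -/

import Mathlib

open Set Filter Topology MeasureTheory

noncomputable section

/-- Euclidean space of dimension `n`. -/
abbrev Euc (n : ℕ) : Type := EuclideanSpace ℝ (Fin n)

/-! ### Comparison functions (conditions on the half line `[0, ∞)`) -/

/-- Class `K`: continuous, strictly increasing, zero at zero. -/
structure IsClassK (γ : ℝ → ℝ) : Prop where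
  continuousOn : ContinuousOn γ (Ici 0)
  strictMonoOn : StrictMonoOn γ (Ici 0)
  map_zero : γ 0 = 0

/-- Class `K∞`: class `K` and unbounded. -/
structure IsClassKInf (γ : ℝ → ℝ) : Prop extends IsClassK γ where
  tendsto_atTop : Tendsto γ atTop atTop

/-- Class `L`: continuous, strictly decreasing, with limit zero (hence positive). -/
structure IsClassL (σ : ℝ → ℝ) : Prop where
  continuousOn : ContinuousOn σ (Ici 0)
  strictAntiOn : StrictAntiOn σ (Ici 0)
  tendsto_zero : Tendsto σ atTop (𝓝 0)

/-- Class `KL`: `β(·, s)` is of class `K` for each `s ≥ 0`, and `β(r, ·)` is of class `L` for each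
`r > 0` (at `r = 0` the first condition forces `β(0, ·) = 0`). -/
structure IsClassKL (β : ℝ → ℝ → ℝ) : Prop where
  left : ∀ s, 0 ≤ s → IsClassK (fun r => β r s)
  right : ∀ r, 0 < r → IsClassL (β r)

/-! ### Plant, generalized equation and algorithm -/

/-- The data of the problem: plant `ẋ = f(x,u,w)`, `y = g(x,w)` with steady-state map `p`,
input set and disturbance set, generalized equation `0 ∈ G(z,s) + A(z)`, `s = h(u,w)`,
`u = q(z)`, and algorithm `T`. -/
structure FESData (nx nu nw ny nz : ℕ) where
  f : Euc nx → Euc nu → Euc nw → Euc nx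
  g : Euc nx → Euc nw → Euc ny
  p : Euc nu → Euc nw → Euc nx
  inputs : Set (Euc nu)
  disturbances : Set (Euc nw)
  G : Euc nz → Euc ny → Euc nz
  A : Euc nz → Set (Euc nz)
  q : Euc nz → Euc nu
  T : Euc nz → Euc ny → Euc nz

/-- The Lyapunov function of the plant together with its constants. -/
structure PlantLyapunov (nx nu nw : ℕ) where
  V : Euc nx → Euc nu → Euc nw → ℝ
  εx : ℝ
  εw : ℝ
  α₃ : ℝ
  α₄ : ℝ
  α₅ : ℝ
  σ₁ : ℝ → ℝ

/-- The merit function of the algorithm together with its comparison functions. -/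
structure AlgorithmMerit (nw nz : ℕ) where
  W : Euc nz → Euc nw → ℝ
  ε : ℝ
  α₁ : ℝ → ℝ
  α₂ : ℝ → ℝ
  α : ℝ → ℝ

/-- Time derivative of a signal on `[0, ∞)` (one-sided at `0`). -/
def signalDeriv {n : ℕ} (w : ℝ → Euc n) (t : ℝ) : Euc n := derivWithin w (Ici 0) t

/-- A set-valued map `Ψ` is strongly regular at `(x, y)`: `y ∈ Ψ x` and the inverse of `Ψ`,
restricted to a neighbourhood of `y` and truncated to a neighbourhood of `x`, is a single-valued
Lipschitz function. -/
def StronglyRegularAt {n : ℕ} (Ψ : Euc n → Set (Euc n)) (x y : Euc n) : Prop :=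
  y ∈ Ψ x ∧ ∃ N ∈ 𝓝 x, ∃ M ∈ 𝓝 y, ∃ φ : Euc n → Euc n, ∃ K : NNReal,
    LipschitzOnWith K φ M ∧ ∀ v ∈ M, {ξ | v ∈ Ψ ξ} ∩ N = {φ v}

namespace FESData

variable {nx nu nw ny nz : ℕ} (D : FESData nx nu nw ny nz)

/-- Steady-state input-output map `h(u,w) = g(p(u,w),w)`. -/
def h (u : Euc nu) (w : Euc nw) : Euc ny := D.g (D.p u w) w

/-- The set-valued map `z ↦ G(z, h(q(z), w)) + A(z)`. -/
def geMap (w : Euc nw) (z : Euc nz) : Set (Euc nz) :=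
  {v | ∃ a ∈ D.A z, v = D.G z (D.h (D.q z) w) + a}

/-- Solution set `S(w)` of the generalized equation. -/
def solutions (w : Euc nw) : Set (Euc nz) := {z | 0 ∈ D.geMap w z}

/-- The nominal iteration map `T(z, h(q(z), w))`. -/
def nominal (z : Euc nz) (w : Euc nw) : Euc nz := D.T z (D.h (D.q z) w)

/-- Admissible disturbance signals: continuously differentiable on `[0, ∞)` with values in the
disturbance set and with bounded derivative. -/
structure Admissible (w : ℝ → Euc nw) : Prop where
  contDiffOn : ContDiffOn ℝ 1 w (Ici 0)
  mem : ∀ t, 0 ≤ t → w t ∈ D.disturbances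
  deriv_bounded : ∃ M : ℝ, ∀ t, 0 ≤ t → ‖signalDeriv w t‖ ≤ M

/-- Robust stability of the plant. In `dissipation` the left-hand side is `V̇(x, u, w(t))`, the
derivative of `V` along `ẋ = f(x, u, w)` with constant input `u`. -/
structure PlantAssumption (P : PlantLyapunov nx nu nw) : Prop where
  f_lip : LocallyLipschitz (fun a : Euc nx × Euc nu × Euc nw => D.f a.1 a.2.1 a.2.2)
  g_lip : ∃ Lg : NNReal, LipschitzWith Lg (fun a : Euc nx × Euc nw => D.g a.1 a.2)
  disturbances_compact : IsCompact D.disturbances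
  disturbances_convex : Convex ℝ D.disturbances
  inputs_compact : IsCompact D.inputs
  inputs_convex : Convex ℝ D.inputs
  steady : ∀ u ∈ D.inputs, ∀ w ∈ D.disturbances, D.f (D.p u w) u w = 0
  εx_pos : 0 < P.εx
  εw_pos : 0 < P.εw
  α₃_pos : 0 < P.α₃
  α₄_pos : 0 < P.α₄
  α₅_pos : 0 < P.α₅
  σ₁_K : IsClassK P.σ₁
  V_contDiff : ContDiff ℝ 1 (fun a : Euc nx × Euc nu × Euc nw => P.V a.1 a.2.1 a.2.2)
  V_lower : ∀ x, ∀ u ∈ D.inputs, ∀ w ∈ D.disturbances,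
    P.α₃ * ‖x - D.p u w‖ ^ 2 ≤ P.V x u w
  V_upper : ∀ x, ∀ u ∈ D.inputs, ∀ w ∈ D.disturbances,
    P.V x u w ≤ P.α₄ * ‖x - D.p u w‖ ^ 2
  dissipation : ∀ w, D.Admissible w → ∀ u ∈ D.inputs, ∀ x, ∀ t, 0 ≤ t →
    P.V x u (w t) ≤ P.εx → ‖signalDeriv w t‖ ≤ P.εw →
    fderiv ℝ (fun a : Euc nx × Euc nu × Euc nw => P.V a.1 a.2.1 a.2.2) (x, u, w t)
        (D.f x u (w t), 0, signalDeriv w t)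
      ≤ -P.α₅ * P.V x u (w t) + P.σ₁ ‖signalDeriv w t‖

/-- Strong regularity of the generalized equation; `q` maps into the input set. -/
structure RegularityAssumption : Prop where
  q_mem : ∀ z, D.q z ∈ D.inputs
  q_lip : ∃ Lq : NNReal, LipschitzWith Lq D.q
  G_contDiff : ContDiff ℝ 1 (fun a : Euc nz × Euc ny => D.G a.1 a.2)
  strongly_regular : ∀ w ∈ D.disturbances, ∀ z ∈ D.solutions w,
    StronglyRegularAt (D.geMap w) z 0

/-- Robust convergence of the algorithm. `stays_near` says that one nominal step from a point
close enough to a solution does not leave the neighbourhood in which `W` is a merit function for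
that solution. -/
structure AlgorithmAssumption (M : AlgorithmMerit nw nz) : Prop where
  fixed_iff : ∀ w ∈ D.disturbances, ∀ z, z = D.nominal z w ↔ z ∈ D.solutions w
  W_cont : ContinuousOn (fun a : Euc nz × Euc nw => M.W a.1 a.2) (univ ×ˢ D.disturbances)
  ε_pos : 0 < M.ε
  α₁_KInf : IsClassKInf M.α₁
  α₂_KInf : IsClassKInf M.α₂
  α_K : IsClassK M.α
  W_lower : ∀ w ∈ D.disturbances, ∀ zb ∈ D.solutions w, ∀ z, ‖z - zb‖ ≤ M.ε →
    M.α₁ ‖z - zb‖ ≤ M.W z w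
  W_upper : ∀ w ∈ D.disturbances, ∀ zb ∈ D.solutions w, ∀ z, ‖z - zb‖ ≤ M.ε →
    M.W z w ≤ M.α₂ ‖z - zb‖
  W_decrease : ∀ w ∈ D.disturbances, ∀ zb ∈ D.solutions w, ∀ z, ‖z - zb‖ ≤ M.ε →
    M.W (D.nominal z w) w ≤ M.W z w - M.α ‖z - zb‖
  stays_near : ∃ δ > 0, ∀ w ∈ D.disturbances, ∀ zb ∈ D.solutions w, ∀ z, ‖z - zb‖ ≤ δ →
    ‖D.nominal z w - zb‖ ≤ M.ε
  T_lip : ∀ R : ℝ, ∃ LT > 0, ∀ z, ‖z‖ ≤ R → ∀ s s', ‖D.T z s - D.T z s'‖ ≤ LT * ‖s - s'‖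

/-- A branch of the solution mapping: a continuous selection of `S` on the disturbance set. -/
structure IsBranch (zbar : Euc nw → Euc nz) : Prop where
  continuousOn : ContinuousOn zbar D.disturbances
  mem : ∀ w ∈ D.disturbances, zbar w ∈ D.solutions w

/-! ### The sampled system -/

/-- `ξ₁ = ψᵏ(ξ₀, v, w̃ᵏ)`: the solution of `ξ̇(t) = f(ξ(t), v, w(t))` started at `ξ₀` at time `kτ`
exists up to time `(k+1)τ` and equals `ξ₁` there. -/
def FlowStep (τ : ℝ) (w : ℝ → Euc nw) (k : ℕ) (v : Euc nu) (ξ₀ ξ₁ : Euc nx) : Prop :=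
  ∃ ξ : ℝ → Euc nx, ξ (k * τ) = ξ₀ ∧ ξ ((k + 1) * τ) = ξ₁ ∧
    ∀ t ∈ Icc (k * τ) ((k + 1) * τ),
      HasDerivWithinAt ξ (D.f (ξ t) v (w t)) (Icc (k * τ) ((k + 1) * τ)) t

/-- Sample `wᵏ = w(kτ)`. -/
def sample (τ : ℝ) (w : ℝ → Euc nw) (k : ℕ) : Euc nw := w (k * τ)

/-- The plant subsystem, driven by an arbitrary sequence `u` of inputs. -/
def PlantTraj (τ : ℝ) (w : ℝ → Euc nw) (u : ℕ → Euc nu) (x : ℕ → Euc nx) : Prop :=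
  (∀ k, u k ∈ D.inputs) ∧ ∀ k, D.FlowStep τ w k (u k) (x k) (x (k + 1))

/-- The algorithm subsystem, driven by an arbitrary sequence of plant states `x k`, equivalently
of plant errors `x k - p(q(z k), w k)`: the measured output is the one that the plant produces one
sampling period after it was in state `x k`. -/
def AlgorithmTraj (τ : ℝ) (w : ℝ → Euc nw) (x : ℕ → Euc nx) (z : ℕ → Euc nz) : Prop :=
  ∀ k, ∃ xnext : Euc nx, D.FlowStep τ w k (D.q (z k)) (x k) xnext ∧
    z (k + 1) = D.T (z k) (D.g xnext (sample τ w (k + 1)))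

/-- The closed loop: `x k+1 = ψ(x k, u k, w̃ k)`, `z k+1 = T(z k, g(x k+1, w k+1))`, `u k = q(z k)`. -/
def ClosedLoopTraj (τ : ℝ) (w : ℝ → Euc nw) (x : ℕ → Euc nx) (z : ℕ → Euc nz) : Prop :=
  ∀ k, D.FlowStep τ w k (D.q (z k)) (x k) (x (k + 1)) ∧
    z (k + 1) = D.T (z k) (D.g (x (k + 1)) (sample τ w (k + 1)))

/-- Norm of the error state `(δx, e)` with `δx = x - p(q(z), w)` and `e = z - zbar(w)`. -/
def errorNorm (zbar : Euc nw → Euc nz) (x : Euc nx) (z : Euc nz) (w : Euc nw) : ℝ :=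
  Real.sqrt (‖x - D.p (D.q z) w‖ ^ 2 + ‖z - zbar w‖ ^ 2)

end FESData

/-- `dᵏ`, the essential supremum of `|ẇ(t)|` over `[kτ, (k+1)τ]`. -/
def distSeq {nw : ℕ} (τ : ℝ) (w : ℝ → Euc nw) (k : ℕ) : ℝ :=
  essSup (fun t => ‖signalDeriv w t‖) (volume.restrict (Icc (k * τ) ((k + 1) * τ)))

/-- `‖d‖ = sup_k dᵏ`. -/
def distNorm {nw : ℕ} (τ : ℝ) (w : ℝ → Euc nw) : ℝ := ⨆ k, distSeq τ w k

/-- `‖Δu‖ = sup_k |u k+1 - u k|`. -/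
def incrNorm {nu : ℕ} (u : ℕ → Euc nu) : ℝ := ⨆ k, ‖u (k + 1) - u k‖

/-! ### Gains of the two subsystems -/

/-- Candidate gains of the plant subsystem. -/
structure PlantGains where
  βx : ℝ → ℝ → ℝ
  γxu : ℝ → ℝ
  γxd : ℝ → ℝ → ℝ
  π₁ : ℝ
  π₂ : ℝ → ℝ

/-- Candidate gains of the algorithm subsystem. -/
structure AlgorithmGains where
  ε₁ : ℝ
  ε₂ : ℝ
  ε₃ : ℝ
  βz : ℝ → ℝ → ℝ
  βu : ℝ → ℝ → ℝ
  γzx : ℝ → ℝ → ℝ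
  γux : ℝ → ℝ → ℝ
  γzd : ℝ → ℝ
  γud : ℝ → ℝ

namespace FESData

variable {nx nu nw ny nz : ℕ} (D : FESData nx nu nw ny nz)

/-- With these gains the plant subsystem is LISS with respect to `Δu` and `d` at sampling
period `τ`. -/
structure PlantLISS (P : PlantLyapunov nx nu nw) (τ : ℝ) (c : PlantGains) : Prop where
  βx_KL : IsClassKL c.βx
  γxu_L : IsClassL c.γxu
  γxd_KL : IsClassKL c.γxd
  π₁_pos : 0 < c.π₁
  π₂_K : IsClassK c.π₂
  estimate : ∀ w, D.Admissible w → ∀ u x, D.PlantTraj τ w u x →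
    P.V (x 0) (u 0) (sample τ w 0) ≤ 0.25 * P.εx →
    incrNorm u ≤ c.π₁ * P.εx →
    c.π₂ (distNorm τ w) ≤ P.εx → distNorm τ w ≤ P.εw →
    ∀ k : ℕ, P.V (x k) (u k) (sample τ w k)
      ≤ c.βx (P.V (x 0) (u 0) (sample τ w 0)) (k * τ) + c.γxu τ * incrNorm u
        + c.γxd (distNorm τ w) τ

/-- With these gains the algorithm subsystem is LIOS near the branch `zbar` at sampling
period `τ`; here `‖V‖` is the supremum of `V(x k, q(z k), w k)`. -/
structure AlgorithmLIOS (P : PlantLyapunov nx nu nw) (M : AlgorithmMerit nw nz)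
    (zbar : Euc nw → Euc nz) (τ : ℝ) (c : AlgorithmGains) : Prop where
  ε₁_pos : 0 < c.ε₁
  ε₂_pos : 0 < c.ε₂
  ε₃_pos : 0 < c.ε₃
  βz_KL : IsClassKL c.βz
  βu_KL : IsClassKL c.βu
  γzx_KL : IsClassKL c.γzx
  γux_KL : IsClassKL c.γux
  γzd_K : IsClassK c.γzd
  γud_K : IsClassK c.γud
  estimate : ∀ w, D.Admissible w → ∀ x z, D.AlgorithmTraj τ w x z →
    ‖z 0 - zbar (sample τ w 0)‖ ≤ M.ε →
    M.W (z 0) (sample τ w 0) ≤ c.ε₁ →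
    BddAbove (range fun j => P.V (x j) (D.q (z j)) (sample τ w j)) →
    (⨆ j, P.V (x j) (D.q (z j)) (sample τ w j)) ≤ c.ε₂ →
    distNorm τ w ≤ c.ε₃ →
    ∀ k : ℕ,
      M.W (z k) (sample τ w k)
        ≤ c.βz (M.W (z 0) (sample τ w 0)) k
          + c.γzx (⨆ j, P.V (x j) (D.q (z j)) (sample τ w j)) τ + c.γzd (distNorm τ w) ∧
      ‖D.q (z (k + 1)) - D.q (z k)‖
        ≤ c.βu (M.W (z 0) (sample τ w 0)) k
          + c.γux (⨆ j, P.V (x j) (D.q (z j)) (sample τ w j)) τ + c.γud (distNorm τ w)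

/-- The discrete-time error interconnection around the branch `zbar` is LISS with respect to `d`
at sampling period `τ`: from small initial errors and for small `d` the closed loop has a solution
for all times, and every solution obeys the LISS estimate. -/
def ClosedLoopLISS (zbar : Euc nw → Euc nz) (τ : ℝ) : Prop :=
  ∃ ε > 0, ∃ β : ℝ → ℝ → ℝ, IsClassKL β ∧ ∃ γ : ℝ → ℝ, IsClassK γ ∧
    ∀ w, D.Admissible w → distNorm τ w ≤ ε →
    ∀ x₀ z₀, D.errorNorm zbar x₀ z₀ (sample τ w 0) ≤ ε →
      (∃ x z, x 0 = x₀ ∧ z 0 = z₀ ∧ D.ClosedLoopTraj τ w x z) ∧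
      ∀ x z, x 0 = x₀ → z 0 = z₀ → D.ClosedLoopTraj τ w x z → ∀ k : ℕ,
        D.errorNorm zbar (x k) (z k) (sample τ w k)
          ≤ β (D.errorNorm zbar x₀ z₀ (sample τ w 0)) k + γ (distNorm τ w)

end FESData

end

/-! Apart from the plant gains, which are explicit, all estimates are obtained from two soft
statements about a family of trajectories: a quantity stays small if initial data and disturbance
are small (stability), and it is small after a uniform number of steps if the disturbance is small
(attractivity). `exists_classKL_estimate` converts such a pair into a `KL` plus `K` bound, so
comparison functions never have to be composed.

Plant gains: integrating the dissipation inequality over one sampling period contracts `V` by `exp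
(-α₅ τ)` towards a level set by `σ₁ ‖d‖` (`V_le_of_flowStep`). Switching the input then costs at
most a multiple of the increment, and a geometric series gives the bound. Algorithm gains: for small
`V` and `d` a real step is close to a nominal step at the new disturbance, so, uniformly over the
compact disturbance set, `W` drops by a fixed `ρ` until it is below `η`
(`IsBranch.exists_step_decrease`).

Closed loop: if `V ≤ s` throughout, the input increments eventually exceed `γux s τ` by little,
hence `V` is eventually at most about `γxu τ * γux s τ`, which is below `s`. On `[η, s₀]` the gap is
uniform by compactness, so finitely many rounds push `V` below `η`, and `W` follows
(`IsBranch.exists_closedLoop_attractivity`). Stability (`IsBranch.exists_closedLoop_bounds`) must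
avoid circularity, because the gain estimates concern infinite trajectories with bounds known in
advance. A finite piece of the loop is therefore continued to an infinite trajectory of each
subsystem separately: with the plant at steady state for the algorithm, with frozen input for the
plant. Then `V` up to time `K` controls the increments up to `K`, and these control `V` at `K + 1`.
The same a priori bound keeps the plant where its flow exists, which yields solutions for all times.
-/

/-! ### Comparison functions -/

namespace IsClassK

variable {γ : ℝ → ℝ}

theorem monotoneOn (h : IsClassK γ) : MonotoneOn γ (Ici 0) := h.strictMonoOn.monotoneOn

theorem mono (h : IsClassK γ) {x y : ℝ} (hx : 0 ≤ x) (hxy : x ≤ y) : γ x ≤ γ y :=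
  h.monotoneOn hx (hx.trans hxy) hxy

theorem nonneg (h : IsClassK γ) {x : ℝ} (hx : 0 ≤ x) : 0 ≤ γ x := by
  simpa [h.map_zero] using h.mono le_rfl hx

theorem pos (h : IsClassK γ) {x : ℝ} (hx : 0 < x) : 0 < γ x := by
  simpa [h.map_zero] using h.strictMonoOn (mem_Ici.2 le_rfl) hx.le hx

theorem exists_forall_le (h : IsClassK γ) {η : ℝ} (hη : 0 < η) :
    ∃ δ > 0, ∀ x, 0 ≤ x → x ≤ δ → γ x ≤ η := by
  have hc := h.continuousOn 0 (mem_Ici.2 le_rfl)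
  obtain ⟨δ, hδ, H⟩ := Metric.continuousWithinAt_iff.1 hc η hη
  refine ⟨δ / 2, by positivity, fun x hx hxδ => ?_⟩
  have := H (x := x) hx (by rw [Real.dist_eq, sub_zero, abs_of_nonneg hx]; linarith)
  rw [h.map_zero, Real.dist_eq, sub_zero] at this
  exact (le_abs_self _).trans this.le

/-- Values of a class `K` function are small only at small arguments. -/
theorem exists_lt_imp_lt (h : IsClassK γ) {η : ℝ} (hη : 0 < η) :
    ∃ δ > 0, ∀ x, 0 ≤ x → γ x ≤ δ → x ≤ η := by
  refine ⟨γ η, h.pos hη, fun x hx hxδ => ?_⟩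
  exact (h.strictMonoOn.le_iff_le hx (mem_Ici.2 hη.le)).1 hxδ

theorem const_mul (h : IsClassK γ) {c : ℝ} (hc : 0 < c) : IsClassK (fun r => c * γ r) where
  continuousOn := continuousOn_const.mul h.continuousOn
  strictMonoOn := fun _ hx _ hy hxy => mul_lt_mul_of_pos_left (h.strictMonoOn hx hy hxy) hc
  map_zero := by simp [h.map_zero]

theorem sqrt_mul (h : IsClassK γ) {c : ℝ} (hc : 0 < c) :
    IsClassK (fun r => √(γ r * c)) where
  continuousOn := (h.continuousOn.mul continuousOn_const).sqrt
  strictMonoOn := fun x hx _ hy hxy => Real.sqrt_lt_sqrt (mul_nonneg (h.nonneg hx) hc.le)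
    (mul_lt_mul_of_pos_right (h.strictMonoOn hx hy hxy) hc)
  map_zero := by simp [h.map_zero]

/-- A class `K` function times a decaying exponential is of class `KL`. -/
theorem mul_exp (h : IsClassK γ) {a : ℝ} (ha : 0 < a) (b : ℝ) :
    IsClassKL (fun r s => γ r * Real.exp (b - a * s)) where
  left s _ := by
    simpa [mul_comm] using h.const_mul (Real.exp_pos (b - a * s))
  right r hr :=
    { continuousOn := by fun_prop
      strictAntiOn := fun x _ y _ hxy => by
        refine mul_lt_mul_of_pos_left (Real.exp_lt_exp.2 ?_) (h.pos hr)
        nlinarith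
      tendsto_zero := by
        have : Tendsto (fun s : ℝ => b - a * s) atTop atBot :=
          tendsto_atBot_add_const_left _ b
            (tendsto_neg_atTop_atBot.comp (tendsto_id.const_mul_atTop ha))
        simpa using (Real.tendsto_exp_atBot.comp this).const_mul (γ r) }

theorem id : IsClassK (fun r => r) :=
  ⟨continuousOn_id, fun _ _ _ _ h => h, rfl⟩

end IsClassK

theorem IsClassL.pos {σ : ℝ → ℝ} (h : IsClassL σ) {x : ℝ} (hx : 0 ≤ x) : 0 < σ x := by
  have h1 : σ (x + 1) < σ x := h.strictAntiOn hx (by simp; linarith) (by linarith)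
  refine lt_of_le_of_lt (le_of_tendsto h.tendsto_zero ?_) h1
  filter_upwards [eventually_ge_atTop (x + 1)] with y hy
  exact h.strictAntiOn.antitoneOn (by simp; linarith) (by simp; linarith) hy

namespace IsClassKL

variable {β : ℝ → ℝ → ℝ}

theorem nonneg (h : IsClassKL β) {r s : ℝ} (hr : 0 ≤ r) (hs : 0 ≤ s) : 0 ≤ β r s :=
  (h.left s hs).nonneg hr

theorem le_zero_right (h : IsClassKL β) {r s : ℝ} (hr : 0 ≤ r) (hs : 0 ≤ s) : β r s ≤ β r 0 := by
  rcases hr.eq_or_lt with rfl | hr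
  · rw [(h.left s hs).map_zero, (h.left 0 le_rfl).map_zero]
  · exact (h.right r hr).strictAntiOn.antitoneOn (mem_Ici.2 le_rfl) hs hs

/-- A class `KL` function tends to zero in its second argument, uniformly for first arguments in a
bounded set. -/
theorem exists_forall_ge (h : IsClassKL β) (R : ℝ) {η : ℝ} (hη : 0 < η) :
    ∃ S : ℝ, 0 ≤ S ∧ ∀ r s, 0 ≤ r → r ≤ R → S ≤ s → β r s ≤ η := by
  have hR : 0 < max R 1 := by positivity
  obtain ⟨S, hS⟩ := eventually_atTop.1 ((h.right _ hR).tendsto_zero.eventually (ge_mem_nhds hη))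
  refine ⟨max S 0, le_max_right _ _, fun r s hr hrR hs => ?_⟩
  exact ((h.left s ((le_max_right _ _).trans hs)).mono hr (hrR.trans (le_max_left _ _))).trans
    (hS s ((le_max_left _ _).trans hs))

end IsClassKL

/-- If `b` is bounded above and small wherever `a` is small, then `b` is bounded by a class `K`
function of `a`. -/
theorem exists_classK_majorant {ι : Type*} (a b : ι → ℝ) (C : ℝ) (ha : ∀ i, 0 ≤ a i)
    (hb : ∀ i, b i ≤ C) (h : ∀ η > 0, ∃ δ > 0, ∀ i, a i ≤ δ → b i ≤ η) :
    ∃ κ, IsClassK κ ∧ ∀ i, b i ≤ κ (a i) := by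
  set C' := max C 1 with hC'
  have hCpos : 0 < C' := by positivity
  choose δ hδ H using fun n : ℕ => h (C' * (1 / 2) ^ n) (by positivity)
  -- The ramp `F n` reaches its full height `C' / 2 ^ n` at `δ (n + 1)`, the threshold of the next
  -- finer level. If `n` is the first index with `δ (n + 1) ≤ a i`, then `a i < δ n` (or `n = 0`),
  -- so this height already bounds `b i`. No monotonicity of `δ` is needed.
  set F : ℕ → ℝ → ℝ := fun n x => C' * (1 / 2) ^ n * max 0 (min 1 (x / δ (n + 1))) with hF
  have hF0 : ∀ n x, 0 ≤ F n x := fun n x => by positivity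
  have hF1 : ∀ n x, F n x ≤ C' * (1 / 2) ^ n := fun n x =>
    mul_le_of_le_one_right (by positivity) (by simp)
  have hu : Summable fun n : ℕ => C' * (1 / 2 : ℝ) ^ n := summable_geometric_two.mul_left _
  have hs : ∀ x, Summable fun n => F n x := fun x =>
    Summable.of_nonneg_of_le (fun n => hF0 n x) (fun n => hF1 n x) hu
  have hmono : ∀ n, Monotone (F n) := fun n x y hxy => by
    simp only [hF]
    have := hδ (n + 1)
    gcongr
  have hterm : ∀ n x, F n x ≤ ∑' n, F n x := fun n x =>
    (hs x).le_tsum n fun m _ => hF0 m x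
  -- The ramps are only weakly increasing; the summand `x` makes the sum strictly increasing.
  refine ⟨fun x => x + ∑' n, F n x, ⟨?_, ?_, ?_⟩, fun i => ?_⟩
  · refine (continuous_id.add (continuous_tsum (fun n => ?_) hu fun n x => ?_)).continuousOn
    · simp only [hF]; fun_prop
    · rw [Real.norm_of_nonneg (hF0 n x)]; exact hF1 n x
  · intro x _ y _ hxy
    exact add_lt_add_of_lt_of_le hxy
      ((hs x).tsum_le_tsum (fun n => hmono n hxy.le) (hs y))
  · simp [hF]
  · by_cases hex : ∃ n, δ (n + 1) ≤ a i
    · classical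
      have hn := Nat.find_spec hex
      set n := Nat.find hex with hn'
      have hbn : b i ≤ C' * (1 / 2) ^ n := by
        rcases Nat.eq_zero_or_pos n with h0 | hpos
        · rw [h0, pow_zero, mul_one]
          exact (hb i).trans (le_max_left C 1)
        · have := Nat.find_min hex (m := n - 1) (by omega)
          rw [Nat.sub_add_cancel hpos, not_le] at this
          exact H n i this.le
      have hFn : F n (a i) = C' * (1 / 2) ^ n := by
        have : 1 ≤ a i / δ (n + 1) := (one_le_div (hδ _)).2 hn
        simp [hF, min_eq_left this]
      have := hterm n (a i)
      have := ha i
      linarith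
    · push Not at hex
      have h0 : b i ≤ 0 := by
        have ht : Tendsto (fun n : ℕ => C' * (1 / 2 : ℝ) ^ (n + 1)) atTop (𝓝 0) := by
          simpa using ((tendsto_pow_atTop_nhds_zero_of_lt_one (by norm_num)
            (by norm_num : (1 / 2 : ℝ) < 1)).comp (tendsto_add_atTop_nat 1)).const_mul C'
        exact ge_of_tendsto' ht fun n => H (n + 1) i (hex n).le
      exact h0.trans (add_nonneg (ha i) (tsum_nonneg fun n => hF0 n _))

/-- Stability and uniform attractivity, both up to a disturbance, give an estimate with class `KL`
and class `K` functions. -/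
theorem exists_classKL_estimate {ι : Type*} (r d : ι → ℝ) (e : ι → ℕ → ℝ) (C : ℝ)
    (hr : ∀ i, 0 ≤ r i) (hd : ∀ i, 0 ≤ d i) (hC : ∀ i k, e i k ≤ C)
    (hstab : ∀ η > 0, ∃ δ > 0, ∀ i, r i ≤ δ → d i ≤ δ → ∀ k, e i k ≤ η)
    (hattr : ∀ η > 0, ∃ δ > 0, ∃ N : ℕ, ∀ i, d i ≤ δ → ∀ k ≥ N, e i k ≤ η) :
    ∃ β, IsClassKL β ∧ ∃ γ, IsClassK γ ∧ ∀ i k, e i k ≤ β (r i) k + γ (d i) := by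
  have hinv : ∀ k : ℕ, (0 : ℝ) < 1 / ((k : ℝ) + 1) := fun k => by positivity
  -- This expression is small exactly when `d` is small and either `r` is small, where stability
  -- applies, or `k` is large, where attractivity applies.
  obtain ⟨κ, hκ, H⟩ := exists_classK_majorant
    (fun j : ι × ℕ => max (d j.1) (min (r j.1) (1 / ((j.2 : ℝ) + 1)))) (fun j => e j.1 j.2) C
    (fun j => le_max_of_le_left (hd _)) (fun j => hC _ _) (by
      intro η hη
      obtain ⟨δ₁, hδ₁, h₁⟩ := hstab η hη
      obtain ⟨δ₂, hδ₂, N, h₂⟩ := hattr η hη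
      refine ⟨min (min δ₁ δ₂) (1 / (N + 1)), by positivity, fun j hj => ?_⟩
      obtain ⟨hj₁, hj₂⟩ := max_le_iff.1 hj
      rcases min_le_iff.1 hj₂ with hj₂ | hj₂
      · exact h₁ _ (hj₂.trans ((min_le_left _ _).trans (min_le_left _ _)))
          (hj₁.trans ((min_le_left _ _).trans (min_le_left _ _))) _
      · refine h₂ _ (hj₁.trans ((min_le_left _ _).trans (min_le_right _ _))) _ ?_
        have := (one_div_le_one_div (by positivity) (by positivity)).1
          (hj₂.trans (min_le_right _ _))
        exact_mod_cast (add_le_add_iff_right 1).1 this)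
  have hκ' : ∀ s : ℝ, 0 ≤ s → 0 < κ (1 / (s + 1)) := fun s hs => hκ.pos (by positivity)
  -- `κ (min r (1 / (s + 1)))` is not strictly monotone in either variable. It is the smaller of `κ
  -- r` and `κ (1 / (s + 1))`, hence at most their geometric mean, which is strictly monotone in
  -- each.
  refine ⟨fun r s => √(κ r * κ (1 / (s + 1))), ⟨fun s hs => hκ.sqrt_mul (hκ' s hs), fun r hr => ?_⟩,
    κ, hκ, fun i k => ?_⟩
  · have hc : ContinuousOn (fun s : ℝ => κ (1 / (s + 1))) (Ici 0) := by
      refine hκ.continuousOn.comp ?_ fun s hs => ?_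
      · refine continuousOn_const.div (by fun_prop) fun s hs => ?_
        have : (0 : ℝ) ≤ s := hs
        positivity
      · have : (0 : ℝ) ≤ s := hs
        exact mem_Ici.2 (by positivity)
    refine ⟨(continuousOn_const.mul hc).sqrt, fun x hx y hy hxy => ?_, ?_⟩
    · have hx' : (0 : ℝ) ≤ x := hx
      have hy' : (0 : ℝ) ≤ y := hy
      refine Real.sqrt_lt_sqrt (mul_nonneg (hκ.pos hr).le (hκ' y hy).le)
        (mul_lt_mul_of_pos_left (hκ.strictMonoOn ?_ ?_ ?_) (hκ.pos hr))
      · exact mem_Ici.2 (by positivity)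
      · exact mem_Ici.2 (by positivity)
      · exact one_div_lt_one_div_of_lt (by linarith) (by linarith)
    · have h1 : Tendsto (fun s : ℝ => 1 / (s + 1)) atTop (𝓝[≥] 0) := by
        refine tendsto_nhdsWithin_iff.2 ⟨?_, ?_⟩
        · simpa [Function.comp_def] using (tendsto_inv_atTop_zero (𝕜 := ℝ)).comp
            (tendsto_atTop_add_const_right _ (1 : ℝ) tendsto_id)
        · filter_upwards [eventually_ge_atTop (0 : ℝ)] with s hs
          exact mem_Ici.2 (by positivity)
      have h2 : Tendsto (fun s : ℝ => κ (1 / (s + 1))) atTop (𝓝 0) := by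
        have := (hκ.continuousOn 0 (mem_Ici.2 le_rfl)).tendsto
        rw [hκ.map_zero] at this
        exact this.comp h1
      simpa using (h2.const_mul (κ r)).sqrt
  · have h0 := H (i, k)
    have hmin : 0 ≤ min (r i) (1 / ((k : ℝ) + 1)) := le_min (hr i) (hinv k).le
    have h1 : κ (max (d i) (min (r i) (1 / ((k : ℝ) + 1)))) ≤
        κ (min (r i) (1 / ((k : ℝ) + 1))) + κ (d i) := by
      rcases max_cases (d i) (min (r i) (1 / ((k : ℝ) + 1))) with ⟨h, -⟩ | ⟨h, -⟩ <;> rw [h]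
      · linarith [hκ.nonneg hmin]
      · linarith [hκ.nonneg (hd i)]
    have h2 : κ (min (r i) (1 / ((k : ℝ) + 1))) ≤ √(κ (r i) * κ (1 / ((k : ℝ) + 1))) := by
      refine Real.le_sqrt_of_sq_le ?_
      rw [sq]
      exact mul_le_mul (hκ.mono hmin (min_le_left _ _)) (hκ.mono hmin (min_le_right _ _))
        (hκ.nonneg hmin) (hκ.nonneg (hr i))
    linarith

/-! ### Disturbance signals -/

theorem natCast_mul_nonneg {τ : ℝ} (hτ : 0 < τ) (k : ℕ) : 0 ≤ (k : ℝ) * τ := by positivity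

theorem Icc_sampling_subset {τ : ℝ} (hτ : 0 < τ) (k : ℕ) :
    Icc ((k : ℝ) * τ) ((k + 1) * τ) ⊆ Ici 0 := fun _ ht =>
  (natCast_mul_nonneg hτ k).trans ht.1

theorem exists_mem_Icc_sampling {τ : ℝ} (hτ : 0 < τ) {t : ℝ} (ht : 0 ≤ t) :
    ∃ k : ℕ, t ∈ Icc ((k : ℝ) * τ) ((k + 1) * τ) := by
  refine ⟨⌊t / τ⌋₊, ?_, ?_⟩
  · exact (le_div_iff₀ hτ).1 (Nat.floor_le (by positivity))
  · exact ((div_lt_iff₀ hτ).1 (Nat.lt_floor_add_one (t / τ))).le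

namespace FESData.Admissible

variable {nx nu nw ny nz : ℕ} {D : FESData nx nu nw ny nz} {w : ℝ → Euc nw} {τ : ℝ}

theorem continuousOn_signalDeriv (h : D.Admissible w) : ContinuousOn (signalDeriv w) (Ici 0) :=
  h.contDiffOn.continuousOn_derivWithin (uniqueDiffOn_Ici 0) le_rfl

theorem differentiableOn (h : D.Admissible w) : DifferentiableOn ℝ w (Ici 0) :=
  h.contDiffOn.differentiableOn one_ne_zero

theorem hasDerivWithinAt (h : D.Admissible w) {t : ℝ} (ht : 0 ≤ t) :
    HasDerivWithinAt w (signalDeriv w t) (Ici 0) t :=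
  (h.differentiableOn t ht).hasDerivWithinAt

theorem sample_mem (h : D.Admissible w) (hτ : 0 < τ) (k : ℕ) :
    sample τ w k ∈ D.disturbances := h.mem _ (natCast_mul_nonneg hτ k)

end FESData.Admissible

theorem distSeq_le {nw : ℕ} {w : ℝ → Euc nw} {τ : ℝ} (hτ : 0 < τ) {C : ℝ}
    (hC : ∀ t, 0 ≤ t → ‖signalDeriv w t‖ ≤ C) (k : ℕ) : distSeq τ w k ≤ C := by
  have hμ : volume.restrict (Icc ((k : ℝ) * τ) ((k + 1) * τ)) ≠ 0 := by
    rw [Ne, Measure.restrict_eq_zero, Real.volume_Icc, ENNReal.ofReal_eq_zero, not_le]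
    linarith
  have : (ae (volume.restrict (Icc ((k : ℝ) * τ) ((k + 1) * τ)))).NeBot := ae_neBot.2 hμ
  refine essSup_le_of_ae_le C ?_ ?_
  · filter_upwards [ae_restrict_mem measurableSet_Icc] with t ht
    exact hC t (Icc_sampling_subset hτ k ht)
  · exact IsBoundedUnder.isCoboundedUnder_le ⟨0, by simp⟩

theorem distNorm_le {nw : ℕ} {w : ℝ → Euc nw} {τ : ℝ} (hτ : 0 < τ) {C : ℝ}
    (hC : ∀ t, 0 ≤ t → ‖signalDeriv w t‖ ≤ C) : distNorm τ w ≤ C :=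
  ciSup_le fun k => distSeq_le hτ hC k

namespace FESData.Admissible

variable {nx nu nw ny nz : ℕ} {D : FESData nx nu nw ny nz} {w : ℝ → Euc nw} {τ : ℝ}

/-- The essential supremum bounds the derivative only almost everywhere; continuity of the
derivative upgrades this to every point, since two continuous functions that agree almost everywhere
on an interval agree on it. -/
theorem norm_signalDeriv_le_distSeq (h : D.Admissible w) (hτ : 0 < τ) (k : ℕ) {t : ℝ}
    (ht : t ∈ Icc ((k : ℝ) * τ) ((k + 1) * τ)) : ‖signalDeriv w t‖ ≤ distSeq τ w k := by
  obtain ⟨C, hC⟩ := h.deriv_bounded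
  have hae : ∀ᵐ t ∂(volume.restrict (Icc ((k : ℝ) * τ) ((k + 1) * τ))),
      ‖signalDeriv w t‖ ≤ distSeq τ w k := by
    refine ae_le_essSup ⟨C, ?_⟩
    rw [eventually_map]
    filter_upwards [ae_restrict_mem measurableSet_Icc] with t ht
    exact hC t (Icc_sampling_subset hτ k ht)
  have heq := Measure.eqOn_Icc_of_ae_eq (μ := volume) (a := (k : ℝ) * τ) (b := (k + 1) * τ)
    (f := fun t => max ‖signalDeriv w t‖ (distSeq τ w k)) (g := fun _ => distSeq τ w k)
    (by linarith) (by filter_upwards [hae] with t ht using max_eq_right ht)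
    ((h.continuousOn_signalDeriv.mono (Icc_sampling_subset hτ k)).norm.sup continuousOn_const)
    continuousOn_const
  exact max_eq_right_iff.1 (heq ht)

theorem norm_signalDeriv_le (h : D.Admissible w) (hτ : 0 < τ) {t : ℝ} (ht : 0 ≤ t) :
    ‖signalDeriv w t‖ ≤ distNorm τ w := by
  obtain ⟨k, hk⟩ := exists_mem_Icc_sampling hτ ht
  obtain ⟨C, hC⟩ := h.deriv_bounded
  exact (h.norm_signalDeriv_le_distSeq hτ k hk).trans
    (le_ciSup (f := distSeq τ w) ⟨C, by rintro _ ⟨j, rfl⟩; exact distSeq_le hτ hC j⟩ k)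

theorem distNorm_nonneg (h : D.Admissible w) (hτ : 0 < τ) : 0 ≤ distNorm τ w :=
  (norm_nonneg _).trans (h.norm_signalDeriv_le hτ le_rfl)

theorem norm_sample_succ_sub_le (h : D.Admissible w) (hτ : 0 < τ) (k : ℕ) :
    ‖sample τ w (k + 1) - sample τ w k‖ ≤ distNorm τ w * τ := by
  have := (convex_Ici (0 : ℝ)).norm_image_sub_le_of_norm_derivWithin_le (𝕜 := ℝ)
    h.differentiableOn (fun t ht => h.norm_signalDeriv_le hτ ht)
    (natCast_mul_nonneg hτ k) (natCast_mul_nonneg hτ (k + 1))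
  refine this.trans_eq ?_
  have e : ((k + 1 : ℕ) : ℝ) * τ - k * τ = τ := by push_cast; ring
  rw [e, Real.norm_of_nonneg hτ.le]

theorem hasDerivWithinAt_shift (h : D.Admissible w) {a : ℝ} (ha : 0 ≤ a) {t : ℝ} (ht : 0 ≤ t) :
    HasDerivWithinAt (fun s => w (s + a)) (signalDeriv w (t + a)) (Ici 0) t := by
  have h1 : HasDerivWithinAt (fun s : ℝ => s + a) 1 (Ici 0) t :=
    ((hasDerivAt_id t).add_const a).hasDerivWithinAt
  have h2 := (h.hasDerivWithinAt (add_nonneg ht ha)).scomp t h1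
    (fun s (hs : (0 : ℝ) ≤ s) => add_nonneg hs ha)
  simpa [Function.comp_def] using h2

theorem signalDeriv_shift (h : D.Admissible w) {a : ℝ} (ha : 0 ≤ a) {t : ℝ} (ht : 0 ≤ t) :
    signalDeriv (fun s => w (s + a)) t = signalDeriv w (t + a) :=
  (h.hasDerivWithinAt_shift ha ht).derivWithin (uniqueDiffOn_Ici 0 t ht)

theorem shift (h : D.Admissible w) {a : ℝ} (ha : 0 ≤ a) : D.Admissible (fun s => w (s + a)) where
  contDiffOn := h.contDiffOn.comp (contDiff_id.add contDiff_const).contDiffOn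
    (fun s (hs : (0 : ℝ) ≤ s) => add_nonneg hs ha)
  mem t ht := h.mem _ (add_nonneg ht ha)
  deriv_bounded := by
    obtain ⟨C, hC⟩ := h.deriv_bounded
    exact ⟨C, fun t ht => by rw [h.signalDeriv_shift ha ht]; exact hC _ (add_nonneg ht ha)⟩

theorem distNorm_shift_le (h : D.Admissible w) (hτ : 0 < τ) {a : ℝ} (ha : 0 ≤ a) :
    distNorm τ (fun s => w (s + a)) ≤ distNorm τ w :=
  distNorm_le hτ fun t ht => by
    rw [h.signalDeriv_shift ha ht]
    exact h.norm_signalDeriv_le hτ (add_nonneg ht ha)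

end FESData.Admissible

/-! ### Time shifts of trajectories by whole sampling periods -/

namespace FESData

variable {nx nu nw ny nz : ℕ} {D : FESData nx nu nw ny nz} {w : ℝ → Euc nw} {τ : ℝ}

theorem sample_shift {nw : ℕ} (τ : ℝ) (w : ℝ → Euc nw) (j k : ℕ) :
    sample τ (fun s => w (s + j * τ)) k = sample τ w (k + j) := by
  simp only [sample]
  congr 1
  push_cast
  ring

theorem FlowStep.shift {k j : ℕ} {v : Euc nu} {ξ₀ ξ₁ : Euc nx}
    (h : D.FlowStep τ w (k + j) v ξ₀ ξ₁) :
    D.FlowStep τ (fun s => w (s + j * τ)) k v ξ₀ ξ₁ := by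
  obtain ⟨ξ, h0, h1, hd⟩ := h
  have e0 : (k : ℝ) * τ + j * τ = ((k + j : ℕ) : ℝ) * τ := by push_cast; ring
  have e1 : ((k : ℝ) + 1) * τ + j * τ = (((k + j : ℕ) : ℝ) + 1) * τ := by push_cast; ring
  have hmaps : MapsTo (fun t : ℝ => t + j * τ) (Icc (k * τ) ((k + 1) * τ))
      (Icc (((k + j : ℕ) : ℝ) * τ) ((((k + j : ℕ) : ℝ) + 1) * τ)) := fun t ht => by
    rw [← e0, ← e1]
    exact ⟨by simpa using ht.1, by simpa using ht.2⟩
  refine ⟨fun t => ξ (t + j * τ), by simp only [e0, h0], by simp only [e1, h1], fun t ht => ?_⟩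
  have h2 := (hd (t + j * τ) (hmaps ht)).scomp t
    ((hasDerivAt_id t).add_const (j * τ)).hasDerivWithinAt hmaps
  simpa [Function.comp_def] using h2

theorem PlantTraj.shift {u : ℕ → Euc nu} {x : ℕ → Euc nx} (h : D.PlantTraj τ w u x) (j : ℕ) :
    D.PlantTraj τ (fun s => w (s + j * τ)) (fun k => u (k + j)) (fun k => x (k + j)) :=
  ⟨fun k => h.1 _, fun k => by
    have := (h.2 (k + j)).shift
    rwa [show k + j + 1 = k + 1 + j by ring] at this⟩

theorem ClosedLoopTraj.shift {x : ℕ → Euc nx} {z : ℕ → Euc nz} (h : D.ClosedLoopTraj τ w x z)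
    (j : ℕ) :
    D.ClosedLoopTraj τ (fun s => w (s + j * τ)) (fun k => x (k + j)) (fun k => z (k + j)) :=
  fun k => by
    obtain ⟨h1, h2⟩ := h (k + j)
    rw [show k + j + 1 = k + 1 + j by ring] at h1 h2
    exact ⟨h1.shift, by rw [sample_shift]; exact h2⟩

theorem ClosedLoopTraj.plantTraj {x : ℕ → Euc nx} {z : ℕ → Euc nz} (h : D.ClosedLoopTraj τ w x z)
    (hq : ∀ z, D.q z ∈ D.inputs) : D.PlantTraj τ w (fun k => D.q (z k)) x :=
  ⟨fun _ => hq _, fun k => (h k).1⟩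

theorem ClosedLoopTraj.algorithmTraj {x : ℕ → Euc nx} {z : ℕ → Euc nz}
    (h : D.ClosedLoopTraj τ w x z) : D.AlgorithmTraj τ w x z :=
  fun k => ⟨_, (h k).1, (h k).2⟩

end FESData

/-! ### Solutions of the plant equation -/

/-- Componentwise truncation to the cube `[-R, R]ⁿ`. -/
def boxClip {n : ℕ} (R : ℝ) (x : Euc n) : Euc n := WithLp.toLp 2 fun i => max (-R) (min R (x i))

theorem boxClip_eq_self {n : ℕ} {R : ℝ} {x : Euc n} (hx : ‖x‖ ≤ R) : boxClip R x = x := by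
  ext i
  have h := abs_le.1 ((PiLp.norm_apply_le x i).trans hx)
  simp [boxClip, min_eq_right h.2, max_eq_right h.1]

theorem lipschitzWith_boxClip {n : ℕ} (R : ℝ) : LipschitzWith 1 (boxClip (n := n) R) := by
  refine LipschitzWith.of_dist_le_mul fun x y => ?_
  rw [NNReal.coe_one, one_mul, EuclideanSpace.dist_eq, EuclideanSpace.dist_eq]
  refine Real.sqrt_le_sqrt (Finset.sum_le_sum fun i _ => ?_)
  gcongr
  have : LipschitzWith 1 fun s : ℝ => max (-R) (min R s) :=
    (LipschitzWith.id.const_min R).const_max (-R)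
  simpa [boxClip] using this.dist_le_mul (x i) (y i)

theorem exists_isCompact_boxClip_mem {n : ℕ} {R : ℝ} (hR : 0 ≤ R) :
    ∃ K : Set (Euc n), IsCompact K ∧ ∀ x, boxClip R x ∈ K := by
  refine ⟨WithLp.toLp 2 '' univ.pi fun _ => Icc (-R) R,
    (isCompact_univ_pi fun _ => isCompact_Icc).image (PiLp.continuous_toLp 2 _), fun x => ?_⟩
  exact mem_image_of_mem _ fun i _ => ⟨le_max_left _ _, max_le (by linarith) (min_le_left _ _)⟩

/-- A bounded, globally Lipschitz, time-continuous vector field has solutions on every compact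
interval. -/
theorem exists_solution_of_lipschitzWith_of_bounded {E : Type*} [NormedAddCommGroup E]
    [NormedSpace ℝ E] [CompleteSpace E] {F : ℝ → E → E} {a b : ℝ} (hab : a ≤ b) {K L : NNReal}
    (hlip : ∀ t ∈ Icc a b, LipschitzWith K (F t)) (hcont : ∀ x, ContinuousOn (F · x) (Icc a b))
    (hbound : ∀ t ∈ Icc a b, ∀ x, ‖F t x‖ ≤ L) (x₀ : E) :
    ∃ ξ : ℝ → E, ξ a = x₀ ∧ ∀ t ∈ Icc a b, HasDerivWithinAt ξ (F t (ξ t)) (Icc a b) t := by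
  -- The radius `L * (b - a)` is the largest distance a curve of speed at most `L` can travel, so no
  -- shorter time interval is needed.
  have h : IsPicardLindelof F (⟨a, left_mem_Icc.2 hab⟩ : Icc a b) x₀ (L * (b - a).toNNReal) 0 L K :=
    { lipschitzOnWith := fun t ht => (hlip t ht).lipschitzOnWith
      continuousOn := fun x _ => hcont x
      norm_le := fun t ht x _ => hbound t ht x
      mul_max_le := by simp [sub_nonneg.2 hab] }
  exact h.exists_eq_forall_mem_Icc_hasDerivWithinAt₀

/-! ### The Lyapunov function along the plant equation -/

namespace FESData.PlantAssumption

variable {nx nu nw ny nz : ℕ} {D : FESData nx nu nw ny nz} {P : PlantLyapunov nx nu nw}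
  {w : ℝ → Euc nw} {τ : ℝ}

theorem V_nonneg (hp : D.PlantAssumption P) (x : Euc nx) {u : Euc nu} (hu : u ∈ D.inputs)
    {ω : Euc nw} (hω : ω ∈ D.disturbances) : 0 ≤ P.V x u ω :=
  (mul_nonneg hp.α₃_pos.le (sq_nonneg _)).trans (hp.V_lower x u hu ω hω)

theorem V_steady (hp : D.PlantAssumption P) {u : Euc nu} (hu : u ∈ D.inputs)
    {ω : Euc nw} (hω : ω ∈ D.disturbances) : P.V (D.p u ω) u ω = 0 :=
  le_antisymm (by simpa using hp.V_upper (D.p u ω) u hu ω hω) (hp.V_nonneg _ hu hω)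

theorem norm_sub_p_le (hp : D.PlantAssumption P) {x : Euc nx} {u : Euc nu} (hu : u ∈ D.inputs)
    {ω : Euc nw} (hω : ω ∈ D.disturbances) {c : ℝ} (hc : P.V x u ω ≤ c) :
    ‖x - D.p u ω‖ ≤ √(c / P.α₃) := by
  refine Real.le_sqrt_of_sq_le ?_
  rw [le_div_iff₀ hp.α₃_pos, mul_comm]
  exact (hp.V_lower x u hu ω hω).trans hc

/-- Sublevel sets of `V` are bounded, uniformly in the input and the disturbance. -/
theorem exists_norm_le (hp : D.PlantAssumption P) (c : ℝ) :
    ∃ R : ℝ, 0 ≤ R ∧ ∀ u ∈ D.inputs, ∀ ω ∈ D.disturbances, ∀ x, P.V x u ω ≤ c → ‖x‖ ≤ R := by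
  have hcont : Continuous fun a : Euc nu × Euc nw => P.V 0 a.1 a.2 :=
    hp.V_contDiff.continuous.comp (by fun_prop : Continuous fun a : Euc nu × Euc nw => ((0 : Euc nx), a.1, a.2))
  obtain ⟨C, hC⟩ := ((hp.inputs_compact.prod hp.disturbances_compact).bddAbove_image
    hcont.continuousOn)
  refine ⟨√(c / P.α₃) + √(C / P.α₃), by positivity, fun u hu ω hω x hx => ?_⟩
  have h1 := hp.norm_sub_p_le hu hω hx
  have h2 := hp.norm_sub_p_le (x := 0) hu hω (c := C) (hC ⟨(u, ω), ⟨hu, hω⟩, rfl⟩)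
  have h3 : ‖x‖ ≤ ‖x - D.p u ω‖ + ‖0 - D.p u ω‖ := by
    rw [zero_sub, norm_neg]
    simpa using norm_add_le (x - D.p u ω) (D.p u ω)
  linarith

/-- On bounded sets of states the Lyapunov function is Lipschitz in the input. -/
theorem exists_V_lipschitz (hp : D.PlantAssumption P) :
    ∃ L : ℝ, 0 < L ∧ ∀ ω ∈ D.disturbances, ∀ u ∈ D.inputs, ∀ u' ∈ D.inputs, ∀ x,
      P.V x u ω ≤ P.εx → P.V x u' ω ≤ P.V x u ω + L * ‖u' - u‖ := by
  obtain ⟨R, -, hR⟩ := hp.exists_norm_le P.εx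
  obtain ⟨K, hK⟩ := LocallyLipschitzOn.exists_lipschitzOnWith_of_compact
    ((isCompact_closedBall (0 : Euc nx) R).prod (hp.inputs_compact.prod hp.disturbances_compact))
    (hp.V_contDiff.locallyLipschitz.locallyLipschitzOn)
  refine ⟨K + 1, by positivity, fun ω hω u hu u' hu' x hx => ?_⟩
  have hxR : x ∈ Metric.closedBall (0 : Euc nx) R := by simpa using hR u hu ω hω x hx
  have h := hK.dist_le_mul (x, u', ω) ⟨hxR, hu', hω⟩ (x, u, ω) ⟨hxR, hu, hω⟩
  have hd : dist ((x, u', ω) : Euc nx × Euc nu × Euc nw) (x, u, ω) = ‖u' - u‖ := by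
    simp [dist_eq_norm]
  rw [hd, Real.dist_eq] at h
  have := (le_abs_self _).trans h
  nlinarith [norm_nonneg (u' - u)]

/-- The dissipation inequality, integrated along a curve that follows the plant equation while the
Lyapunov function is small. -/
theorem V_le_of_hasDerivWithinAt (hp : D.PlantAssumption P) (hw : D.Admissible w) {a b d S : ℝ}
    (ha : 0 ≤ a) (hd : ∀ t ∈ Icc a b, ‖signalDeriv w t‖ ≤ d) (hdε : d ≤ P.εw)
    (hS : P.σ₁ d ≤ P.α₅ * S) (hSε : S < P.εx) {v : Euc nu} (hv : v ∈ D.inputs) {ξ : ℝ → Euc nx}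
    {c : Euc nx → Euc nx}
    (hξ : ∀ t ∈ Icc a b, HasDerivWithinAt ξ (D.f (c (ξ t)) v (w t)) (Icc a b) t)
    (hc : ∀ t ∈ Icc a b, P.V (ξ t) v (w t) ≤ P.εx → c (ξ t) = ξ t)
    (h0 : P.V (ξ a) v (w a) < P.εx) {t : ℝ} (ht : t ∈ Icc a b) :
    P.V (ξ t) v (w t) ≤
      Real.exp (-P.α₅ * (t - a)) * P.V (ξ a) v (w a) + (1 - Real.exp (-P.α₅ * (t - a))) * S := by
  set E : ℝ → ℝ := fun t => Real.exp (-P.α₅ * (t - a)) with hE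
  set V₀ := P.V (ξ a) v (w a) with hV₀
  have hsub : Icc a b ⊆ Ici 0 := fun s hs => ha.trans hs.1
  have hEle : ∀ s ∈ Icc a b, E s ≤ 1 := fun s hs => by
    rw [hE, Real.exp_le_one_iff]
    nlinarith [hp.α₅_pos, hs.1]
  have hEd : ∀ s, HasDerivAt E (-P.α₅ * E s) s := fun s => by
    have := (((hasDerivAt_id s).sub_const a).const_mul (-P.α₅)).exp
    simpa [hE, mul_comm] using this
  have hcurve : ∀ s ∈ Icc a b, HasDerivWithinAt (fun s => P.V (ξ s) v (w s))
      (fderiv ℝ (fun a : Euc nx × Euc nu × Euc nw => P.V a.1 a.2.1 a.2.2) (ξ s, v, w s)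
        (D.f (c (ξ s)) v (w s), 0, signalDeriv w s)) (Icc a b) s := fun s hs => by
    have h1 := (hξ s hs).prodMk ((hasDerivWithinAt_const s (Icc a b) v).prodMk
      ((hw.hasDerivWithinAt (hsub hs)).mono hsub))
    exact ((hp.V_contDiff.differentiable one_ne_zero).differentiableAt.hasFDerivAt
      (x := (ξ s, v, w s))).comp_hasDerivWithinAt s h1
  -- The margin `η` makes the differential inequality strict at a contact point with the comparison
  -- curve; it is sent to zero afterwards.
  suffices H : ∀ η > 0, max V₀ S + η ≤ P.εx →
      P.V (ξ t) v (w t) ≤ E t * (V₀ - S) + S + η by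
    have hpos : 0 < P.εx - max V₀ S := sub_pos.2 (max_lt h0 hSε)
    have : P.V (ξ t) v (w t) ≤ E t * (V₀ - S) + S := by
      refine le_of_forall_pos_le_add fun η hη => ?_
      have := H (min η (P.εx - max V₀ S)) (lt_min hη hpos)
        (by linarith [min_le_right η (P.εx - max V₀ S)])
      linarith [min_le_left η (P.εx - max V₀ S)]
    linarith
  intro η hη hηε
  refine image_le_of_deriv_right_lt_deriv_boundary' (f := fun s => P.V (ξ s) v (w s))
    (B := fun s => E s * (V₀ - S) + S + η) (B' := fun s => -P.α₅ * E s * (V₀ - S))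
    (fun s hs => (hcurve s hs).continuousWithinAt)
    (fun s hs => (hcurve s (Ico_subset_Icc_self hs)).mono_of_mem_nhdsWithin
      (Icc_mem_nhdsGE_of_mem hs)) ?_ (by fun_prop) (fun s hs => ?_) (fun s hs hB => ?_) ht
  · simp [hE, ← hV₀, hη.le]
  · exact ((((hEd s).mul_const (V₀ - S)).add_const S).add_const η).hasDerivWithinAt
  · have hs' := Ico_subset_Icc_self hs
    have hE0 : 0 < E s := Real.exp_pos _
    -- At a contact point `V` equals a convex combination of `V₀` and `S` plus `η`, hence is at most
    -- `εx`. So the dissipation inequality is available, and `c` acts as the identity, precisely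
    -- where the comparison needs them.
    have hle : P.V (ξ s) v (w s) ≤ P.εx := by
      refine le_trans ?_ hηε
      rw [show P.V (ξ s) v (w s) = E s * (V₀ - S) + S + η from hB]
      have h1 := mul_le_mul_of_nonneg_left (le_max_left V₀ S) hE0.le
      have h2 := mul_le_mul_of_nonneg_left (le_max_right V₀ S) (sub_nonneg.2 (hEle s hs'))
      linarith
    have hdis := hp.dissipation w hw v hv (ξ s) s (hsub hs') hle ((hd s hs').trans hdε)
    rw [hc s hs' hle]
    have hσ := hp.σ₁_K.mono (norm_nonneg (signalDeriv w s)) (hd s hs')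
    have hB' : P.V (ξ s) v (w s) = E s * (V₀ - S) + S + η := hB
    have := mul_pos hp.α₅_pos hη
    nlinarith

theorem V_le_of_flowStep (hp : D.PlantAssumption P) (hw : D.Admissible w) (hτ : 0 < τ) {S : ℝ}
    (hdε : distNorm τ w ≤ P.εw) (hS : P.σ₁ (distNorm τ w) ≤ P.α₅ * S) (hSε : S < P.εx)
    {v : Euc nu} (hv : v ∈ D.inputs) {k : ℕ} {ξ₀ ξ₁ : Euc nx}
    (h0 : P.V ξ₀ v (sample τ w k) < P.εx) (h : D.FlowStep τ w k v ξ₀ ξ₁) :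
    P.V ξ₁ v (sample τ w (k + 1)) ≤
      Real.exp (-P.α₅ * τ) * P.V ξ₀ v (sample τ w k) + (1 - Real.exp (-P.α₅ * τ)) * S := by
  obtain ⟨ξ, rfl, rfl, hξ⟩ := h
  have hab : (k : ℝ) * τ ≤ (k + 1) * τ := by linarith
  have := hp.V_le_of_hasDerivWithinAt hw (natCast_mul_nonneg hτ k) (b := (k + 1) * τ)
    (fun t ht => hw.norm_signalDeriv_le hτ (Icc_sampling_subset hτ k ht)) hdε hS hSε hv
    (c := fun x => x) hξ (fun _ _ _ => rfl) h0 (right_mem_Icc.2 hab)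
  rw [show ((k : ℝ) + 1) * τ - k * τ = τ by ring] at this
  simpa [sample] using this

/-- As `f` is only locally Lipschitz, the state is first truncated to a cube containing the sublevel
set `V ≤ εx`, which gives a bounded, globally Lipschitz field. The decay of `V` keeps the solution
in that sublevel set, where the truncation does nothing, so it solves the original equation. -/
theorem exists_flowStep (hp : D.PlantAssumption P) (hw : D.Admissible w) (hτ : 0 < τ) {S : ℝ}
    (hdε : distNorm τ w ≤ P.εw) (hS : P.σ₁ (distNorm τ w) ≤ P.α₅ * S) (hSε : S < P.εx)
    {v : Euc nu} (hv : v ∈ D.inputs) (k : ℕ) {ξ₀ : Euc nx}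
    (h0 : P.V ξ₀ v (sample τ w k) < P.εx) : ∃ ξ₁, D.FlowStep τ w k v ξ₀ ξ₁ := by
  obtain ⟨R, hR0, hR⟩ := hp.exists_norm_le P.εx
  obtain ⟨K, hK, hclip⟩ := exists_isCompact_boxClip_mem (n := nx) hR0
  have hcomp := hK.prod ((isCompact_singleton (x := v)).prod hp.disturbances_compact)
  obtain ⟨L, hL⟩ := hcomp.exists_bound_of_continuousOn hp.f_lip.continuous.continuousOn
  obtain ⟨Λ, hΛ⟩ := LocallyLipschitzOn.exists_lipschitzOnWith_of_compact hcomp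
    hp.f_lip.locallyLipschitzOn
  have hab : (k : ℝ) * τ ≤ (k + 1) * τ := by linarith
  have hsub := Icc_sampling_subset hτ k
  have hmem : ∀ t ∈ Icc ((k : ℝ) * τ) ((k + 1) * τ), ∀ x, (boxClip R x, v, w t) ∈
      K ×ˢ ({v} ×ˢ D.disturbances) := fun t ht x => ⟨hclip x, rfl, hw.mem t (hsub ht)⟩
  obtain ⟨ξ, hξ0, hξ⟩ := exists_solution_of_lipschitzWith_of_bounded
    (F := fun t x => D.f (boxClip R x) v (w t)) hab (K := Λ) (L := L.toNNReal)
    (fun t ht => LipschitzWith.of_dist_le_mul fun x y => by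
      refine (hΛ.dist_le_mul _ (hmem t ht x) _ (hmem t ht y)).trans ?_
      gcongr
      simpa [Prod.dist_eq] using (lipschitzWith_boxClip R).dist_le_mul x y)
    (fun x => hp.f_lip.continuous.comp_continuousOn (continuousOn_const.prodMk
      (continuousOn_const.prodMk (hw.differentiableOn.continuousOn.mono hsub))))
    (fun t ht x => (hL _ (hmem t ht x)).trans (Real.le_coe_toNNReal L)) ξ₀
  have hclipV : ∀ t ∈ Icc ((k : ℝ) * τ) ((k + 1) * τ), P.V (ξ t) v (w t) ≤ P.εx →
      boxClip R (ξ t) = ξ t := fun t ht hV =>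
    boxClip_eq_self (hR v hv (w t) (hw.mem t (hsub ht)) _ hV)
  refine ⟨ξ ((k + 1) * τ), ξ, hξ0, rfl, fun t ht => ?_⟩
  have h0' : P.V (ξ (k * τ)) v (w (k * τ)) < P.εx := by rw [hξ0]; exact h0
  have hV := hp.V_le_of_hasDerivWithinAt hw (natCast_mul_nonneg hτ k) (b := (k + 1) * τ)
    (fun t ht => hw.norm_signalDeriv_le hτ (hsub ht)) hdε hS hSε hv hξ hclipV h0' ht
  have he0 : 0 < Real.exp (-P.α₅ * (t - k * τ)) := Real.exp_pos _
  have he1 : Real.exp (-P.α₅ * (t - k * τ)) ≤ 1 := by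
    rw [Real.exp_le_one_iff]
    nlinarith [hp.α₅_pos, ht.1]
  have hle : P.V (ξ t) v (w t) ≤ P.εx := hV.trans (by nlinarith)
  have := hξ t ht
  rwa [hclipV t ht hle] at this

end FESData.PlantAssumption

/-! ### Gains of the plant subsystem -/

namespace FESData

variable {nx nu nw ny nz : ℕ} {D : FESData nx nu nw ny nz} {P : PlantLyapunov nx nu nw}

namespace PlantAssumption

theorem exists_norm_input_sub_le (hp : D.PlantAssumption P) :
    ∃ C : ℝ, ∀ u ∈ D.inputs, ∀ u' ∈ D.inputs, ‖u' - u‖ ≤ C := by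
  obtain ⟨C, hC⟩ := Metric.isBounded_iff.1 hp.inputs_compact.isBounded
  exact ⟨C, fun u hu u' hu' => by rw [← dist_eq_norm]; exact hC hu' hu⟩

theorem norm_sub_le_incrNorm (hp : D.PlantAssumption P) {u : ℕ → Euc nu}
    (hu : ∀ k, u k ∈ D.inputs) (k : ℕ) : ‖u (k + 1) - u k‖ ≤ incrNorm u := by
  obtain ⟨C, hC⟩ := hp.exists_norm_input_sub_le
  exact le_ciSup (f := fun k => ‖u (k + 1) - u k‖)
    ⟨C, by rintro _ ⟨j, rfl⟩; exact hC _ (hu _) _ (hu _)⟩ k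

theorem exists_plantLISS (hp : D.PlantAssumption P) {τ : ℝ} (hτ : 0 < τ) :
    ∃ c : PlantGains, D.PlantLISS P τ c := by
  obtain ⟨L, hL, hlip⟩ := hp.exists_V_lipschitz
  have hα := hp.α₅_pos
  have hε := hp.εx_pos
  set l := Real.exp (-P.α₅ * τ) with hl
  have hl0 : 0 < l := Real.exp_pos _
  have hl1 : l < 1 := by rw [hl, Real.exp_lt_one_iff]; nlinarith
  have hl1' : 0 < 1 - l := sub_pos.2 hl1
  have hg : 0 < L / (1 - l) := by positivity
  -- The gains matter only at `s = τ`; the factor `exp (τ - s)` equals one there and supplies the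
  -- required decay in `s`. The constants in `π₁` and `π₂` make the input and disturbance terms at
  -- most `εx / 8` each, so with `V 0 ≤ εx / 4` the bound stays below `εx / 2`.
  refine ⟨⟨fun r s => r * Real.exp (0 - P.α₅ * s), fun s => L / (1 - l) * Real.exp (τ - 1 * s),
    fun r s => 1 / P.α₅ * P.σ₁ r * Real.exp (τ - 1 * s), (1 - l) / (8 * L),
    fun r => 8 / P.α₅ * P.σ₁ r⟩, ?_, ?_, ?_, ?_, ?_, ?_⟩
  · exact IsClassK.id.mul_exp hα 0
  · exact (IsClassK.id.mul_exp one_pos τ).right _ hg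
  · exact (hp.σ₁_K.const_mul (by positivity)).mul_exp one_pos τ
  · exact div_pos hl1' (by positivity)
  · exact hp.σ₁_K.const_mul (by positivity)
  intro w hw u x hT hV0 hu hd hdε
  simp only at hu hd ⊢
  set S := 1 / P.α₅ * P.σ₁ (distNorm τ w) with hSdef
  set U := incrNorm u with hU
  have hS : P.σ₁ (distNorm τ w) ≤ P.α₅ * S := by rw [hSdef]; field_simp; rfl
  have hS8 : S ≤ P.εx / 8 := by
    have : 8 * S = 8 / P.α₅ * P.σ₁ (distNorm τ w) := by rw [hSdef]; ring
    linarith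
  set I := L / (1 - l) * U with hI
  have hI8 : I ≤ P.εx / 8 := by
    calc I ≤ L / (1 - l) * ((1 - l) / (8 * L) * P.εx) := by rw [hI]; gcongr
      _ = P.εx / 8 := by field_simp
  have hIU : L * U = (1 - l) * I := by rw [hI]; field_simp
  have hV0' := hp.V_nonneg (x 0) (hT.1 0) (hw.sample_mem hτ 0)
  have key : ∀ k : ℕ, P.V (x k) (u k) (sample τ w k) ≤
      l ^ k * P.V (x 0) (u 0) (sample τ w 0) + I + S := by
    intro k
    induction k with
    | zero =>
      have : 0 ≤ I := by
        rw [hI]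
        exact mul_nonneg hg.le ((norm_nonneg _).trans (hp.norm_sub_le_incrNorm hT.1 0))
      have : 0 ≤ S := by
        rw [hSdef]
        exact mul_nonneg (by positivity) (hp.σ₁_K.nonneg (hw.distNorm_nonneg hτ))
      simp only [pow_zero, one_mul]
      linarith
    | succ k ih =>
      have hlk : l ^ k * P.V (x 0) (u 0) (sample τ w 0) ≤ P.V (x 0) (u 0) (sample τ w 0) :=
        mul_le_of_le_one_left hV0' (pow_le_one₀ hl0.le hl1.le)
      have hVk : P.V (x k) (u k) (sample τ w k) ≤ P.εx / 2 := by linarith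
      -- The flow acts with the old input and `h2` then switches the input at the new state, so `V
      -- (k + 1) ≤ l * V k + (1 - l) * (S + I)`.
      have h1 := hp.V_le_of_flowStep hw hτ hdε hS (by linarith) (hT.1 k) (by linarith) (hT.2 k)
      rw [← hl] at h1
      have h2 := hlip _ (hw.sample_mem hτ (k + 1)) _ (hT.1 k) _ (hT.1 (k + 1)) (x (k + 1))
        (by nlinarith)
      have h3 := mul_le_mul_of_nonneg_left (hp.norm_sub_le_incrNorm hT.1 k) hL.le
      have h4 := mul_le_mul_of_nonneg_left ih hl0.le
      rw [← hU] at h3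
      rw [pow_succ]
      nlinarith
  intro k
  have hk := key k
  have e1 : l ^ k = Real.exp (0 - P.α₅ * (k * τ)) := by
    rw [hl, ← Real.exp_nat_mul]; congr 1; ring
  rw [one_mul, sub_self, Real.exp_zero, mul_one, mul_one, ← e1]
  linarith

end PlantAssumption

end FESData

/-! ### Gains of the algorithm subsystem -/

theorem le_max_of_succ_le_max_sub {a : ℕ → ℝ} {ρ η c : ℝ} (h0 : a 0 ≤ c) (hρ : 0 ≤ ρ)
    (h : ∀ k, a (k + 1) ≤ max (a k - ρ) η) (k : ℕ) : a k ≤ max (c - k * ρ) η := by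
  induction k with
  | zero => simpa using Or.inl h0
  | succ k ih =>
    refine (h k).trans (max_le ?_ (le_max_right _ _))
    rcases le_max_iff.1 ih with h2 | h2
    · refine le_max_of_le_left ?_
      push_cast
      linarith
    · exact le_max_of_le_right (by linarith)

namespace FESData

variable {nx nu nw ny nz : ℕ} {D : FESData nx nu nw ny nz} {P : PlantLyapunov nx nu nw}
  {M : AlgorithmMerit nw nz} {zbar : Euc nw → Euc nz} {τ : ℝ}

theorem IsBranch.exists_modulus (hb : D.IsBranch zbar) (hp : D.PlantAssumption P) {η : ℝ}
    (hη : 0 < η) : ∃ δ > 0, ∀ ω ∈ D.disturbances, ∀ ω' ∈ D.disturbances, ‖ω' - ω‖ ≤ δ →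
      ‖zbar ω' - zbar ω‖ ≤ η := by
  obtain ⟨δ, hδ, H⟩ := Metric.uniformContinuousOn_iff_le.1
    (hp.disturbances_compact.uniformContinuousOn_of_continuous hb.continuousOn) η hη
  exact ⟨δ, hδ, fun ω hω ω' hω' h => by
    simpa [dist_eq_norm] using H ω' hω' ω hω (by rwa [dist_eq_norm])⟩

theorem IsBranch.exists_bound (hb : D.IsBranch zbar) (hp : D.PlantAssumption P) :
    ∃ R, ∀ ω ∈ D.disturbances, ‖zbar ω‖ ≤ R :=
  hp.disturbances_compact.exists_bound_of_continuousOn hb.continuousOn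

theorem AlgorithmAssumption.exists_W_modulus (ha : D.AlgorithmAssumption M)
    (hp : D.PlantAssumption P) (R : ℝ) {η : ℝ} (hη : 0 < η) :
    ∃ δ > 0, ∀ ω ∈ D.disturbances, ∀ ω' ∈ D.disturbances, ∀ z z', ‖z‖ ≤ R → ‖z'‖ ≤ R →
      ‖ω' - ω‖ ≤ δ → ‖z' - z‖ ≤ δ → M.W z' ω' ≤ M.W z ω + η := by
  obtain ⟨δ, hδ, H⟩ := Metric.uniformContinuousOn_iff_le.1
    (((isCompact_closedBall (0 : Euc nz) R).prod
      hp.disturbances_compact).uniformContinuousOn_of_continuous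
      (ha.W_cont.mono (prod_mono (subset_univ _) subset_rfl))) η hη
  refine ⟨δ, hδ, fun ω hω ω' hω' z z' hz hz' h1 h2 => ?_⟩
  have := H (z', ω') ⟨by simpa using hz', hω'⟩ (z, ω) ⟨by simpa using hz, hω⟩
    (by rw [Prod.dist_eq, dist_eq_norm, dist_eq_norm]; exact max_le h2 h1)
  have := (le_abs_self _).trans this
  simp only at this
  linarith

/-- One perturbed nominal step near the branch: the iterate stays near the branch and the merit
function decreases by a fixed amount until it is below `η`. -/
theorem IsBranch.exists_merit_decrease (hb : D.IsBranch zbar) (hp : D.PlantAssumption P)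
    (ha : D.AlgorithmAssumption M) :
    ∃ c > 0, ∀ η > 0, ∃ ρ > 0, ∃ δ > 0, ∀ ω ∈ D.disturbances, ∀ ω' ∈ D.disturbances,
      ‖ω' - ω‖ ≤ δ → ∀ z z', ‖z - zbar ω‖ ≤ M.ε → M.W z ω ≤ c → ‖z' - D.nominal z ω'‖ ≤ δ →
        ‖z' - zbar ω'‖ ≤ M.ε ∧ M.W z' ω' ≤ max (M.W z ω - ρ) η := by
  have hε := ha.ε_pos
  obtain ⟨δs, hδs, hstay⟩ := ha.stays_near
  set m := min M.ε δs / 2 with hm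
  have hm0 : 0 < m := by positivity
  obtain ⟨c, hc, hα₁⟩ := ha.α₁_KInf.toIsClassK.exists_lt_imp_lt
    (lt_min hm0 (half_pos hε))
  obtain ⟨Rz, hRz⟩ := hb.exists_bound hp
  refine ⟨c / 2, by positivity, fun η hη => ?_⟩
  obtain ⟨s, hs, hα₂⟩ := ha.α₂_KInf.toIsClassK.exists_forall_le (by positivity : 0 < η / 4)
  have hαs := ha.α_K.pos hs
  -- Passing from `ω` to `ω'` and from the nominal iterate to `z'` each cost `ρ` in `W`. A nominal
  -- decrease of `3 * ρ` therefore leaves a net decrease `ρ`.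
  set ρ := min (M.α s / 3) (min (η / 4) (c / 2)) with hρ
  have hρ0 : 0 < ρ := by positivity
  have hρ1 : 3 * ρ ≤ M.α s := by linarith [min_le_left (M.α s / 3) (min (η / 4) (c / 2))]
  have hρ2 : ρ ≤ η / 4 := (min_le_right _ _).trans (min_le_left _ _)
  have hρ3 : ρ ≤ c / 2 := (min_le_right _ _).trans (min_le_right _ _)
  obtain ⟨δ₁, hδ₁, hW⟩ := ha.exists_W_modulus hp (Rz + M.ε) hρ0
  obtain ⟨δ₂, hδ₂, hz⟩ := hb.exists_modulus hp hm0
  refine ⟨ρ, hρ0, min (min δ₁ δ₂) (M.ε / 2), by positivity,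
    fun ω hω ω' hω' hωω z z' hez hWz hz' => ?_⟩
  have hωω₁ := hωω.trans ((min_le_left _ _).trans (min_le_left _ _))
  have hωω₂ := hωω.trans ((min_le_left _ _).trans (min_le_right _ _))
  have hz'₁ := hz'.trans ((min_le_left _ _).trans (min_le_left _ _))
  have hz'₂ := hz'.trans (min_le_right _ _)
  have hball : ∀ ω ∈ D.disturbances, ∀ y, ‖y - zbar ω‖ ≤ M.ε → ‖y‖ ≤ Rz + M.ε :=
    fun ω hω y hy => by
      have := norm_le_norm_add_norm_sub' y (zbar ω)
      linarith [hRz ω hω]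
  have he : ‖z - zbar ω‖ ≤ m :=
    (hα₁ _ (norm_nonneg _) (by linarith [ha.W_lower ω hω _ (hb.mem ω hω) z hez])).trans
      (min_le_left _ _)
  have he' : ‖z - zbar ω'‖ ≤ 2 * m := by
    have h1 := hz ω hω ω' hω' hωω₂
    have h2 := norm_sub_le_norm_sub_add_norm_sub z (zbar ω) (zbar ω')
    rw [norm_sub_rev (zbar ω)] at h2
    linarith
  have he'ε : ‖z - zbar ω'‖ ≤ M.ε := he'.trans (by linarith [min_le_left M.ε δs])
  have hnom : ‖D.nominal z ω' - zbar ω'‖ ≤ M.ε :=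
    hstay ω' hω' _ (hb.mem ω' hω') z (he'.trans (by linarith [min_le_right M.ε δs]))
  have hW1 : M.W z ω' ≤ M.W z ω + ρ :=
    hW ω hω ω' hω' z z (hball ω hω z hez) (hball ω hω z hez) hωω₁ (by simpa using hδ₁.le)
  have hdec := ha.W_decrease ω' hω' _ (hb.mem ω' hω') z he'ε
  have hα0 := ha.α_K.nonneg (norm_nonneg (z - zbar ω'))
  -- `stays_near` gives only the radius `ε`, but this makes the lower bound on `W` applicable at the
  -- nominal iterate. The decrease of `W` then improves the radius to `ε / 2`, leaving room for the
  -- perturbation.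
  have hnom2 : ‖D.nominal z ω' - zbar ω'‖ ≤ M.ε / 2 :=
    (hα₁ _ (norm_nonneg _)
      (by linarith [ha.W_lower ω' hω' _ (hb.mem ω' hω') _ hnom])).trans (min_le_right _ _)
  have hz'e : ‖z' - zbar ω'‖ ≤ M.ε := by
    have := norm_sub_le_norm_sub_add_norm_sub z' (D.nominal z ω') (zbar ω')
    linarith
  have hW2 : M.W z' ω' ≤ M.W (D.nominal z ω') ω' + ρ :=
    hW ω' hω' ω' hω' _ _ (hball ω' hω' _ hnom) (hball ω' hω' _ hz'e) (by simpa using hδ₁.le) hz'₁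
  refine ⟨hz'e, ?_⟩
  rcases le_total ‖z - zbar ω'‖ s with hle | hle
  · refine le_max_of_le_right ?_
    have h1 := ha.W_upper ω' hω' _ (hb.mem ω' hω') z he'ε
    have h2 := hα₂ _ (norm_nonneg _) hle
    linarith
  · refine le_max_of_le_left ?_
    have := ha.α_K.mono hs.le hle
    linarith

/-- The measured output differs little from the steady-state output when the plant is close to
its steady state and the disturbance varies slowly. -/
theorem exists_perturbation_le (hp : D.PlantAssumption P) (hreg : D.RegularityAssumption)
    (ha : D.AlgorithmAssumption M) (hτ : 0 < τ) (R : ℝ) {η : ℝ} (hη : 0 < η) :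
    ∃ δ > 0, ∀ w, D.Admissible w → distNorm τ w ≤ δ → ∀ k z x x', ‖z‖ ≤ R →
      P.V x (D.q z) (sample τ w k) ≤ δ → D.FlowStep τ w k (D.q z) x x' →
      ‖D.T z (D.g x' (sample τ w (k + 1))) - D.nominal z (sample τ w (k + 1))‖ ≤ η := by
  obtain ⟨Lg, hLg⟩ := hp.g_lip
  obtain ⟨LT, hLT, hT⟩ := ha.T_lip R
  have hα₃ := hp.α₃_pos
  have hα₅ := hp.α₅_pos
  have hεx := hp.εx_pos
  -- `a` is the allowed distance of the plant from steady state; `Lg + 1` avoids a zero denominator.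
  -- The level `c` of `V` enforces this distance.
  set a := η / (LT * (Lg + 1)) with hadef
  have ha0 : 0 < a := by positivity
  set c := min (P.α₃ * a ^ 2) P.εx with hc
  have hc0 : 0 < c := by positivity
  obtain ⟨δ₁, hδ₁, hσ⟩ := hp.σ₁_K.exists_forall_le (by positivity : 0 < P.α₅ * (c / 2))
  refine ⟨min (min δ₁ P.εw) (c / 2), by have := hp.εw_pos; positivity,
    fun w hw hd k z x x' hz hV hflow => ?_⟩
  have hd0 := hw.distNorm_nonneg hτ
  have hd₁ := hd.trans ((min_le_left _ _).trans (min_le_left _ _))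
  have hd₂ := hd.trans ((min_le_left _ _).trans (min_le_right _ _))
  have hV' := hV.trans (min_le_right _ _)
  have hcε : c ≤ P.εx := min_le_right _ _
  have h1 := hp.V_le_of_flowStep hw hτ hd₂ (hσ _ hd0 hd₁) (by linarith) (hreg.q_mem z)
    (by linarith) hflow
  have he0 : 0 < Real.exp (-P.α₅ * τ) := Real.exp_pos _
  have hV1 : P.V x' (D.q z) (sample τ w (k + 1)) ≤ P.α₃ * a ^ 2 := by
    have : c ≤ P.α₃ * a ^ 2 := min_le_left _ _
    nlinarith
  have h2 := hp.norm_sub_p_le (hreg.q_mem z) (hw.sample_mem hτ (k + 1)) hV1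
  rw [mul_div_cancel_left₀ _ hα₃.ne', Real.sqrt_sq ha0.le] at h2
  have h3 := hLg.dist_le_mul (x', sample τ w (k + 1))
    (D.p (D.q z) (sample τ w (k + 1)), sample τ w (k + 1))
  rw [Prod.dist_eq, dist_self, max_eq_left dist_nonneg, dist_eq_norm, dist_eq_norm] at h3
  have h4 := hT z hz (D.g x' (sample τ w (k + 1))) (D.h (D.q z) (sample τ w (k + 1)))
  refine h4.trans ?_
  have h5 : ‖D.g x' (sample τ w (k + 1)) - D.h (D.q z) (sample τ w (k + 1))‖ ≤ (Lg + 1) * a := by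
    refine h3.trans ?_
    gcongr
    linarith
  calc LT * _ ≤ LT * ((Lg + 1) * a) := by gcongr
    _ = η := by rw [hadef]; field_simp

/-- One step of the algorithm subsystem near the branch. -/
theorem IsBranch.exists_step_decrease (hb : D.IsBranch zbar) (hp : D.PlantAssumption P)
    (hreg : D.RegularityAssumption) (ha : D.AlgorithmAssumption M) (hτ : 0 < τ) :
    ∃ c > 0, ∀ η > 0, ∃ ρ > 0, ∃ δ > 0, ∀ w, D.Admissible w → distNorm τ w ≤ δ → ∀ k z x x',
      P.V x (D.q z) (sample τ w k) ≤ δ → D.FlowStep τ w k (D.q z) x x' →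
      ‖z - zbar (sample τ w k)‖ ≤ M.ε → M.W z (sample τ w k) ≤ c →
      ‖D.T z (D.g x' (sample τ w (k + 1))) - zbar (sample τ w (k + 1))‖ ≤ M.ε ∧
      M.W (D.T z (D.g x' (sample τ w (k + 1)))) (sample τ w (k + 1)) ≤
        max (M.W z (sample τ w k) - ρ) η := by
  obtain ⟨c, hc, H⟩ := hb.exists_merit_decrease hp ha
  obtain ⟨Rz, hRz⟩ := hb.exists_bound hp
  refine ⟨c, hc, fun η hη => ?_⟩
  obtain ⟨ρ, hρ, δ₁, hδ₁, H⟩ := H η hη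
  obtain ⟨δ₂, hδ₂, H₂⟩ := exists_perturbation_le hp hreg ha hτ (Rz + M.ε) hδ₁
  refine ⟨ρ, hρ, min (δ₁ / τ) δ₂, by positivity, fun w hw hd k z x x' hV hflow hz hW => ?_⟩
  refine H _ (hw.sample_mem hτ k) _ (hw.sample_mem hτ (k + 1)) ?_ z _ hz hW
    (H₂ w hw (hd.trans (min_le_right _ _)) k z x x' ?_ (hV.trans (min_le_right _ _)) hflow)
  · exact (hw.norm_sample_succ_sub_le hτ k).trans
      ((le_div_iff₀ hτ).1 (hd.trans (min_le_left _ _)))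
  · have := norm_le_norm_add_norm_sub' z (zbar (sample τ w k))
    linarith [hRz _ (hw.sample_mem hτ k)]

/-- Trajectories of the algorithm subsystem near the branch: the merit function does not grow above
`η` and is eventually below `η`. -/
theorem IsBranch.exists_merit_bounds (hb : D.IsBranch zbar) (hp : D.PlantAssumption P)
    (hreg : D.RegularityAssumption) (ha : D.AlgorithmAssumption M) (hτ : 0 < τ) :
    ∃ c > 0, ∀ η > 0, ∃ δ > 0, ∃ N : ℕ, ∀ w, D.Admissible w → distNorm τ w ≤ δ →
      ∀ x z, D.AlgorithmTraj τ w x z → (∀ k, P.V (x k) (D.q (z k)) (sample τ w k) ≤ δ) →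
      ‖z 0 - zbar (sample τ w 0)‖ ≤ M.ε → M.W (z 0) (sample τ w 0) ≤ c →
      (∀ k, ‖z k - zbar (sample τ w k)‖ ≤ M.ε ∧
        M.W (z k) (sample τ w k) ≤ max (M.W (z 0) (sample τ w 0)) η) ∧
      ∀ k ≥ N, M.W (z k) (sample τ w k) ≤ η := by
  obtain ⟨c, hc, H⟩ := hb.exists_step_decrease hp hreg ha hτ
  refine ⟨c, hc, fun η hη => ?_⟩
  -- The cap by `c` keeps `W ≤ c` invariant even when `η > c`.
  obtain ⟨ρ, hρ, δ, hδ, H⟩ := H (min η c) (lt_min hη hc)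
  refine ⟨δ, hδ, ⌈c / ρ⌉₊, fun w hw hd x z hT hV hz0 hW0 => ?_⟩
  have hstep : ∀ k, ‖z k - zbar (sample τ w k)‖ ≤ M.ε → M.W (z k) (sample τ w k) ≤ c →
      ‖z (k + 1) - zbar (sample τ w (k + 1))‖ ≤ M.ε ∧
      M.W (z (k + 1)) (sample τ w (k + 1)) ≤ max (M.W (z k) (sample τ w k) - ρ) (min η c) :=
    fun k hz hW => by
      obtain ⟨x', hflow, hz'⟩ := hT k
      rw [hz']
      exact H w hw hd k (z k) (x k) x' (hV k) hflow hz hW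
  have hinv : ∀ k, ‖z k - zbar (sample τ w k)‖ ≤ M.ε ∧ M.W (z k) (sample τ w k) ≤ c := by
    intro k
    induction k with
    | zero => exact ⟨hz0, hW0⟩
    | succ k ih =>
      obtain ⟨h1, h2⟩ := hstep k ih.1 ih.2
      exact ⟨h1, h2.trans (max_le (by linarith [ih.2]) (min_le_right _ _))⟩
  have hdec := fun k => (hstep k (hinv k).1 (hinv k).2).2
  have hbound := le_max_of_succ_le_max_sub (a := fun k => M.W (z k) (sample τ w k)) le_rfl hρ.le hdec
  refine ⟨fun k => ⟨(hinv k).1, (hbound k).trans (max_le_max ?_ (min_le_left _ _))⟩,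
    fun k hk => ?_⟩
  · have : 0 ≤ (k : ℝ) * ρ := by positivity
    linarith
  · refine (hbound k).trans (max_le ?_ (min_le_left _ _))
    have := (div_le_iff₀ hρ).1 ((Nat.le_ceil (c / ρ)).trans (Nat.cast_le.2 hk))
    linarith

theorem AlgorithmAssumption.norm_error_le (ha : D.AlgorithmAssumption M) {η : ℝ} (hη : 0 < η) :
    ∃ δ > 0, ∀ ω ∈ D.disturbances, ∀ zb ∈ D.solutions ω, ∀ z, ‖z - zb‖ ≤ M.ε → M.W z ω ≤ δ →
      ‖z - zb‖ ≤ η := by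
  obtain ⟨δ, hδ, H⟩ := ha.α₁_KInf.toIsClassK.exists_lt_imp_lt hη
  exact ⟨δ, hδ, fun ω hω zb hzb z hz hW =>
    H _ (norm_nonneg _) ((ha.W_lower ω hω zb hzb z hz).trans hW)⟩

theorem AlgorithmAssumption.W_nonneg (ha : D.AlgorithmAssumption M) {ω : Euc nw}
    (hω : ω ∈ D.disturbances) {zb : Euc nz} (hzb : zb ∈ D.solutions ω) {z : Euc nz}
    (hz : ‖z - zb‖ ≤ M.ε) : 0 ≤ M.W z ω :=
  (ha.α₁_KInf.toIsClassK.nonneg (norm_nonneg _)).trans (ha.W_lower ω hω zb hzb z hz)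

/-- Input increments are small when the merit function is small and the disturbance varies
slowly. -/
theorem IsBranch.exists_norm_increment_le (hb : D.IsBranch zbar) (hp : D.PlantAssumption P)
    (hreg : D.RegularityAssumption) (ha : D.AlgorithmAssumption M) (hτ : 0 < τ) {η : ℝ}
    (hη : 0 < η) :
    ∃ δ > 0, ∀ w, D.Admissible w → distNorm τ w ≤ δ → ∀ k z z',
      ‖z - zbar (sample τ w k)‖ ≤ M.ε → ‖z' - zbar (sample τ w (k + 1))‖ ≤ M.ε →
      M.W z (sample τ w k) ≤ δ → M.W z' (sample τ w (k + 1)) ≤ δ → ‖D.q z' - D.q z‖ ≤ η := by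
  obtain ⟨Lq, hLq⟩ := hreg.q_lip
  have hη' : 0 < η / (3 * (Lq + 1)) := by positivity
  obtain ⟨δ₁, hδ₁, h₁⟩ := ha.norm_error_le hη'
  obtain ⟨δ₂, hδ₂, h₂⟩ := hb.exists_modulus hp hη'
  refine ⟨min δ₁ (δ₂ / τ), by positivity, fun w hw hd k z z' hz hz' hW hW' => ?_⟩
  have hs := hw.sample_mem hτ k
  have hs' := hw.sample_mem hτ (k + 1)
  have e1 := h₁ _ hs _ (hb.mem _ hs) z hz (hW.trans (min_le_left _ _))
  have e2 := h₁ _ hs' _ (hb.mem _ hs') z' hz' (hW'.trans (min_le_left _ _))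
  have e3 := h₂ _ hs _ hs' ((hw.norm_sample_succ_sub_le hτ k).trans
    ((le_div_iff₀ hτ).1 (hd.trans (min_le_right _ _))))
  have h4 : ‖z' - z‖ ≤ 3 * (η / (3 * (Lq + 1))) := by
    have h5 := norm_sub_le_norm_sub_add_norm_sub z' (zbar (sample τ w (k + 1))) z
    have h6 := norm_sub_le_norm_sub_add_norm_sub (zbar (sample τ w (k + 1)))
      (zbar (sample τ w k)) z
    rw [norm_sub_rev (zbar (sample τ w k)) z] at h6
    linarith
  have h5 := hLq.dist_le_mul z' z
  rw [dist_eq_norm, dist_eq_norm] at h5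
  calc ‖D.q z' - D.q z‖ ≤ Lq * ‖z' - z‖ := h5
    _ ≤ (Lq + 1) * (3 * (η / (3 * (Lq + 1)))) := by gcongr; linarith
    _ = η := by field_simp

/-- All trajectories in the region of validity form one family, with `max ‖V‖ ‖d‖` as a single
disturbance. `exists_classKL_estimate` is applied to `W` and to the input increments, and the class
`K` function of the maximum is split into a sum. -/
theorem IsBranch.exists_algorithmLIOS (hb : D.IsBranch zbar) (hp : D.PlantAssumption P)
    (hreg : D.RegularityAssumption) (ha : D.AlgorithmAssumption M) (hτ : 0 < τ) :
    ∃ c : AlgorithmGains, D.AlgorithmLIOS P M zbar τ c := by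
  obtain ⟨c, hc, H⟩ := hb.exists_merit_bounds hp hreg ha hτ
  obtain ⟨δ₀, hδ₀, N₀, H₀⟩ := H c hc
  let v : (ℕ → Euc nx) → (ℕ → Euc nz) → (ℝ → Euc nw) → ℝ := fun x z w =>
    ⨆ j, P.V (x j) (D.q (z j)) (sample τ w j)
  let good : (ℝ → Euc nw) × (ℕ → Euc nx) × (ℕ → Euc nz) → Prop := fun a =>
    D.Admissible a.1 ∧ D.AlgorithmTraj τ a.1 a.2.1 a.2.2 ∧
    ‖a.2.2 0 - zbar (sample τ a.1 0)‖ ≤ M.ε ∧ M.W (a.2.2 0) (sample τ a.1 0) ≤ c ∧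
    BddAbove (range fun j => P.V (a.2.1 j) (D.q (a.2.2 j)) (sample τ a.1 j)) ∧
    v a.2.1 a.2.2 a.1 ≤ δ₀ ∧ distNorm τ a.1 ≤ δ₀
  let r : {a // good a} → ℝ := fun a => M.W (a.1.2.2 0) (sample τ a.1.1 0)
  let d : {a // good a} → ℝ := fun a => max (v a.1.2.1 a.1.2.2 a.1.1) (distNorm τ a.1.1)
  let e : {a // good a} → ℕ → ℝ := fun a k => M.W (a.1.2.2 k) (sample τ a.1.1 k)
  let i : {a // good a} → ℕ → ℝ := fun a k => ‖D.q (a.1.2.2 (k + 1)) - D.q (a.1.2.2 k)‖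
  have hle : ∀ a : {a // good a}, ∀ k,
      P.V (a.1.2.1 k) (D.q (a.1.2.2 k)) (sample τ a.1.1 k) ≤ v a.1.2.1 a.1.2.2 a.1.1 :=
    fun a k => le_ciSup a.2.2.2.2.2.1 k
  have hv0 : ∀ a : {a // good a}, 0 ≤ v a.1.2.1 a.1.2.2 a.1.1 := fun a =>
    (hp.V_nonneg _ (hreg.q_mem _) (a.2.1.sample_mem hτ 0)).trans (hle a 0)
  have hd0 : ∀ a, 0 ≤ d a := fun a => le_max_of_le_left (hv0 a)
  have hr0 : ∀ a, 0 ≤ r a := fun a =>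
    ha.W_nonneg (a.2.1.sample_mem hτ 0) (hb.mem _ (a.2.1.sample_mem hτ 0)) a.2.2.2.1
  have hinv : ∀ a : {a // good a}, ∀ k, ‖a.1.2.2 k - zbar (sample τ a.1.1 k)‖ ≤ M.ε ∧ e a k ≤ c :=
    fun a k => by
      obtain ⟨hw, hT, h0, hW, hB, hv, hd⟩ := a.2
      have := (H₀ _ hw hd _ _ hT (fun k => (hle a k).trans hv) h0 hW).1 k
      exact ⟨this.1, this.2.trans (max_le hW le_rfl)⟩
  have hstab : ∀ η > 0, ∃ δ > 0, ∀ a, r a ≤ δ → d a ≤ δ → ∀ k, e a k ≤ η := fun η hη => by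
    obtain ⟨δ, hδ, N, H⟩ := H η hη
    refine ⟨min δ η, lt_min hδ hη, fun a hr hd k => ?_⟩
    obtain ⟨hw, hT, h0, hW, hB, -⟩ := a.2
    obtain ⟨hd1, hd2⟩ := max_le_iff.1 (hd.trans (min_le_left _ _))
    exact (((H _ hw hd2 _ _ hT (fun k => (hle a k).trans hd1) h0 hW).1 k).2).trans
      (max_le (hr.trans (min_le_right _ _)) le_rfl)
  have hattr : ∀ η > 0, ∃ δ > 0, ∃ N : ℕ, ∀ a, d a ≤ δ → ∀ k ≥ N, e a k ≤ η := fun η hη => by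
    obtain ⟨δ, hδ, N, H⟩ := H η hη
    refine ⟨δ, hδ, N, fun a hd => ?_⟩
    obtain ⟨hw, hT, h0, hW, hB, -⟩ := a.2
    obtain ⟨hd1, hd2⟩ := max_le_iff.1 hd
    exact (H _ hw hd2 _ _ hT (fun k => (hle a k).trans hd1) h0 hW).2
  obtain ⟨βz, hβz, κz, hκz, hz⟩ := exists_classKL_estimate r d e c hr0 hd0
    (fun a k => (hinv a k).2) hstab hattr
  obtain ⟨C, hC⟩ := hp.exists_norm_input_sub_le
  have hincr : ∀ η > 0, ∃ δ > 0, ∀ a, ∀ k, d a ≤ δ → e a k ≤ δ → e a (k + 1) ≤ δ → i a k ≤ η :=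
    fun η hη => by
      obtain ⟨δ, hδ, H⟩ := hb.exists_norm_increment_le hp hreg ha hτ hη
      exact ⟨δ, hδ, fun a k hd h1 h2 => H _ a.2.1 ((le_max_right _ _).trans hd) k _ _
        (hinv a k).1 (hinv a (k + 1)).1 h1 h2⟩
  obtain ⟨βu, hβu, κu, hκu, hu⟩ := exists_classKL_estimate r d i C hr0 hd0
    (fun a k => hC _ (hreg.q_mem _) _ (hreg.q_mem _))
    (fun η hη => by
      obtain ⟨δ₁, hδ₁, h₁⟩ := hincr η hη
      obtain ⟨δ₂, hδ₂, h₂⟩ := hstab δ₁ hδ₁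
      exact ⟨min δ₁ δ₂, lt_min hδ₁ hδ₂, fun a hr hd k =>
        have h3 := h₂ a (hr.trans (min_le_right _ _)) (hd.trans (min_le_right _ _))
        h₁ a k (hd.trans (min_le_left _ _)) (h3 k) (h3 (k + 1))⟩)
    (fun η hη => by
      obtain ⟨δ₁, hδ₁, h₁⟩ := hincr η hη
      obtain ⟨δ₂, hδ₂, N, h₂⟩ := hattr δ₁ hδ₁
      exact ⟨min δ₁ δ₂, lt_min hδ₁ hδ₂, N, fun a hd k hk =>
        have h3 := h₂ a (hd.trans (min_le_right _ _))
        h₁ a k (hd.trans (min_le_left _ _)) (h3 k hk) (h3 (k + 1) (hk.trans (Nat.le_succ k)))⟩)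
  refine ⟨⟨c, δ₀, δ₀, βz, βu, fun r s => κz r * Real.exp (τ - 1 * s),
    fun r s => κu r * Real.exp (τ - 1 * s), κz, κu⟩, hc, hδ₀, hδ₀, hβz, hβu,
    hκz.mul_exp one_pos τ, hκu.mul_exp one_pos τ, hκz, hκu,
    fun w hw x z hT h0 hW hB hv hd k => ?_⟩
  let a : {a // good a} := ⟨(w, x, z), hw, hT, h0, hW, hB, hv, hd⟩
  have hmax : ∀ κ : ℝ → ℝ, IsClassK κ → κ (d a) ≤ κ (v x z w) + κ (distNorm τ w) :=
    fun κ hκ => by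
      have h1 := hκ.nonneg (hv0 a)
      have h2 := hκ.nonneg (hw.distNorm_nonneg hτ)
      simp only [d, a]
      rcases max_cases (v x z w) (distNorm τ w) with ⟨h, -⟩ | ⟨h, -⟩ <;> rw [h]
      · linarith
      · have h3 : 0 ≤ κ (v x z w) := h1
        linarith
  simp only [one_mul, sub_self, Real.exp_zero, mul_one]
  have h1 := hz a k
  have h2 := hu a k
  have h3 := hmax κz hκz
  have h4 := hmax κu hκu
  simp only [a, r, e, i, v] at h1 h2 h3 h4
  exact ⟨by linarith, by linarith⟩

end FESData

/-! ### Extending trajectories -/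

/-- Dependent choice for a relation whose next element is guaranteed only along genuine initial
pieces. This fits the closed loop, where the flow exists because of an a priori bound on the
trajectory so far. -/
theorem exists_seq_of_forall_partial {α : Type*} (R : ℕ → α → α → Prop) (a₀ : α)
    (h : ∀ (K : ℕ) (a : ℕ → α), a 0 = a₀ → (∀ k < K, R k (a k) (a (k + 1))) → ∃ b, R K (a K) b) :
    ∃ a : ℕ → α, a 0 = a₀ ∧ ∀ k, R k (a k) (a (k + 1)) := by
  classical
  let next : ℕ → α → α := fun k s => if h : ∃ b, R k s b then h.choose else s
  let a : ℕ → α := fun k => Nat.rec a₀ next k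
  refine ⟨a, rfl, fun k => ?_⟩
  induction k using Nat.strong_induction_on with
  | _ K ih =>
    have hex := h K a rfl ih
    have : a (K + 1) = hex.choose := dif_pos hex
    rw [this]
    exact hex.choose_spec

theorem exists_seq_extend {α : Type*} (R : ℕ → α → α → Prop) (Q : ℕ → α → Prop) (a : ℕ → α)
    (K : ℕ) (hQ : Q K (a K))
    (h : ∀ k s, K ≤ k → Q k s → ∃ s', R k s s' ∧ Q (k + 1) s') :
    ∃ b : ℕ → α, (∀ k ≤ K, b k = a k) ∧ ∀ k ≥ K, R k (b k) (b (k + 1)) := by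
  obtain ⟨c, hc0, hc⟩ := exists_seq_of_forall_partial
    (fun k s s' => R (K + k) s s' ∧ Q (K + k + 1) s') (a K) (fun k c hc0 hc => by
      refine h (K + k) (c k) (Nat.le_add_right _ _) ?_
      rcases k with _ | k
      · simpa [hc0] using hQ
      · exact (hc k (Nat.lt_succ_self k)).2)
  refine ⟨fun k => if k ≤ K then a k else c (k - K), fun k hk => if_pos hk, fun k hk => ?_⟩
  have h1 := (hc (k - K)).1
  have h2 : (if k ≤ K then a k else c (k - K)) = c (k - K) := by
    split_ifs with hkK
    · obtain rfl := le_antisymm hk hkK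
      simp [hc0]
    · rfl
  simp only [h2, if_neg (by omega : ¬ k + 1 ≤ K), show k + 1 - K = k - K + 1 by omega]
  rwa [show K + (k - K) = k by omega] at h1

namespace FESData

variable {nx nu nw ny nz : ℕ} {D : FESData nx nu nw ny nz} {P : PlantLyapunov nx nu nw}
  {M : AlgorithmMerit nw nz} {zbar : Euc nw → Euc nz} {τ : ℝ} {w : ℝ → Euc nw}

/-- One step of the closed loop. -/
def ClosedLoopStep (D : FESData nx nu nw ny nz) (τ : ℝ) (w : ℝ → Euc nw) (x : ℕ → Euc nx)
    (z : ℕ → Euc nz) (k : ℕ) : Prop :=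
  D.FlowStep τ w k (D.q (z k)) (x k) (x (k + 1)) ∧
    z (k + 1) = D.T (z k) (D.g (x (k + 1)) (sample τ w (k + 1)))

/-- A finite piece of a closed-loop trajectory extends to a trajectory of the algorithm subsystem
along which the plant is in steady state after the given piece. -/
theorem exists_algorithmTraj_extend (hp : D.PlantAssumption P) (hreg : D.RegularityAssumption)
    (hw : D.Admissible w) (hτ : 0 < τ) {S : ℝ} (hdε : distNorm τ w ≤ P.εw)
    (hS : P.σ₁ (distNorm τ w) ≤ P.α₅ * S) (hSε : S < P.εx) {x : ℕ → Euc nx} {z : ℕ → Euc nz}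
    {K : ℕ} (h : ∀ k < K + 1, D.ClosedLoopStep τ w x z k) :
    ∃ x' z', D.AlgorithmTraj τ w x' z' ∧ (∀ k ≤ K, x' k = x k) ∧ (∀ k ≤ K + 1, z' k = z k) ∧
      ∀ k > K, P.V (x' k) (D.q (z' k)) (sample τ w k) = 0 := by
  obtain ⟨z', hz', hR⟩ := exists_seq_extend
    (fun k ζ ζ' => ∃ ξ, D.FlowStep τ w k (D.q ζ) (D.p (D.q ζ) (sample τ w k)) ξ ∧
      ζ' = D.T ζ (D.g ξ (sample τ w (k + 1)))) (fun _ _ => True) z (K + 1) trivial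
    (fun k ζ _ _ => by
      obtain ⟨ξ, hξ⟩ := hp.exists_flowStep hw hτ hdε hS hSε (hreg.q_mem ζ) k
        (ξ₀ := D.p (D.q ζ) (sample τ w k))
        (by rw [hp.V_steady (hreg.q_mem ζ) (hw.sample_mem hτ k)]; exact hp.εx_pos)
      exact ⟨_, ⟨ξ, hξ, rfl⟩, trivial⟩)
  -- The plant state is a free input of the algorithm subsystem. Resetting it to steady state after
  -- `K` makes `V` vanish there, so the tail adds nothing to `‖V‖`.
  refine ⟨fun k => if k ≤ K then x k else D.p (D.q (z' k)) (sample τ w k), z', fun k => ?_,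
    fun k hk => if_pos hk, hz', fun k hk => ?_⟩
  · by_cases hk : k ≤ K
    · obtain ⟨h1, h2⟩ := h k (Nat.lt_succ_of_le hk)
      beta_reduce
      rw [if_pos hk, hz' k (by omega), hz' (k + 1) (by omega)]
      exact ⟨_, h1, h2⟩
    · beta_reduce
      rw [if_neg hk]
      exact hR k (by omega)
  · beta_reduce
    rw [if_neg (not_le.2 hk)]
    exact hp.V_steady (hreg.q_mem _) (hw.sample_mem hτ k)

/-- A finite piece of a plant trajectory extends to a trajectory with constant input. -/
theorem exists_plantTraj_extend (hp : D.PlantAssumption P)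
    (hw : D.Admissible w) (hτ : 0 < τ) {S : ℝ} (hdε : distNorm τ w ≤ P.εw)
    (hS : P.σ₁ (distNorm τ w) ≤ P.α₅ * S) (hSε : S < P.εx) {x : ℕ → Euc nx} {u : ℕ → Euc nu}
    {K : ℕ} (hu : ∀ k, u k ∈ D.inputs) (h : ∀ k < K, D.FlowStep τ w k (u k) (x k) (x (k + 1)))
    (hV : P.V (x K) (u K) (sample τ w K) < P.εx) :
    ∃ x', D.PlantTraj τ w (fun k => u (min k K)) x' ∧ ∀ k ≤ K, x' k = x k := by
  -- Freezing the input after `K` creates no further increments, and `V < εx` propagates because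
  -- each step bounds `V` by a convex combination of its old value and `S`.
  obtain ⟨x', hx', hR⟩ := exists_seq_extend
    (fun k ξ ξ' => D.FlowStep τ w k (u K) ξ ξ') (fun k ξ => P.V ξ (u K) (sample τ w k) < P.εx)
    x K hV (fun k ξ _ hξ => by
      obtain ⟨ξ', hξ'⟩ := hp.exists_flowStep hw hτ hdε hS hSε (hu K) k hξ
      refine ⟨ξ', hξ', (hp.V_le_of_flowStep hw hτ hdε hS hSε (hu K) hξ hξ').trans_lt ?_⟩
      have he0 : 0 < Real.exp (-P.α₅ * τ) := Real.exp_pos _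
      have he1 : Real.exp (-P.α₅ * τ) ≤ 1 := by
        rw [Real.exp_le_one_iff]
        nlinarith [hp.α₅_pos]
      nlinarith)
  refine ⟨x', ⟨fun k => hu _, fun k => ?_⟩, hx'⟩
  rcases lt_or_ge k K with hk | hk
  · beta_reduce
    rw [min_eq_left hk.le, hx' k hk.le, hx' (k + 1) hk]
    exact h k hk
  · beta_reduce
    rw [min_eq_right hk]
    exact hR k hk

/-! ### The small-gain argument -/

/-- Local stability of finite pieces of closed-loop trajectories. -/
theorem IsBranch.exists_closedLoop_bounds (hb : D.IsBranch zbar) (hp : D.PlantAssumption P)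
    (hreg : D.RegularityAssumption) (ha : D.AlgorithmAssumption M) (hτ : 0 < τ)
    {cp : PlantGains} {ca : AlgorithmGains} (hP : D.PlantLISS P τ cp)
    (hA : D.AlgorithmLIOS P M zbar τ ca)
    (hgain : ∀ s, 0 < s → s ≤ min (0.25 * P.εx) ca.ε₂ → cp.γxu τ * ca.γux s τ < s)
    {η : ℝ} (hη : 0 < η) :
    ∃ δ > 0, ∀ w, D.Admissible w → distNorm τ w ≤ δ → ∀ x z,
      ‖z 0 - zbar (sample τ w 0)‖ ≤ M.ε → P.V (x 0) (D.q (z 0)) (sample τ w 0) ≤ δ →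
      M.W (z 0) (sample τ w 0) ≤ δ → ∀ K, (∀ k < K, D.ClosedLoopStep τ w x z k) → ∀ k ≤ K,
      P.V (x k) (D.q (z k)) (sample τ w k) ≤ η ∧ ‖z k - zbar (sample τ w k)‖ ≤ M.ε ∧
        M.W (z k) (sample τ w k) ≤ η := by
  have hεx := hp.εx_pos
  have hα₅ := hp.α₅_pos
  have hε₁ := hA.ε₁_pos
  have hε₂ := hA.ε₂_pos
  have hε₃ := hA.ε₃_pos
  have hπ₁ := hP.π₁_pos
  have hεw := hp.εw_pos
  obtain ⟨L, hL, hlip⟩ := hp.exists_V_lipschitz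
  obtain ⟨c₀, hc₀, Hstep⟩ := hb.exists_step_decrease hp hreg ha hτ
  set c := min η (min c₀ ca.ε₁) with hc
  have hc0 : 0 < c := by positivity
  have hcη : c ≤ η := min_le_left _ _
  have hcc₀ : c ≤ c₀ := (min_le_right _ _).trans (min_le_left _ _)
  have hcε₁ : c ≤ ca.ε₁ := (min_le_right _ _).trans (min_le_right _ _)
  obtain ⟨ρ, hρ, δ₁, hδ₁, Hstep⟩ := Hstep c hc0
  set a := cp.γxu τ with ha_def
  have ha0 : 0 < a := hP.γxu_L.pos hτ.le
  have hKux := hA.γux_KL.left τ hτ.le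
  set U := min (cp.π₁ * P.εx) (P.εx / (8 * L)) with hU
  have hU0 : 0 < U := by positivity
  have hU1 : U ≤ cp.π₁ * P.εx := min_le_left _ _
  have hU2 : L * U ≤ P.εx / 8 := by
    calc L * U ≤ L * (P.εx / (8 * L)) := by gcongr; exact min_le_right _ _
      _ = P.εx / 8 := by field_simp
  obtain ⟨sU, hsU, HsU⟩ := hKux.exists_forall_le (half_pos hU0)
  set s := min (min η δ₁) (min (min (P.εx / 8) ca.ε₂) sU) with hs
  have hs0 : 0 < s := by positivity
  have hsη : s ≤ η := (min_le_left _ _).trans (min_le_left _ _)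
  have hsδ₁ : s ≤ δ₁ := (min_le_left _ _).trans (min_le_right _ _)
  have hsε₂ : s ≤ ca.ε₂ := ((min_le_right _ _).trans (min_le_left _ _)).trans (min_le_right _ _)
  have hs8 : s ≤ P.εx / 8 := ((min_le_right _ _).trans (min_le_left _ _)).trans (min_le_left _ _)
  have hsU' : ca.γux s τ ≤ U / 2 := HsU s hs0.le ((min_le_right _ _).trans (min_le_right _ _))
  have hg : 0 < s - a * ca.γux s τ :=
    sub_pos.2 (hgain s hs0 (le_min (by norm_num; linarith) hsε₂))
  -- The gap `g` is the error budget: `2 * a * θ` takes at most half of it, the initial plant error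
  -- and the disturbance a quarter each, so the bound at time `K + 1` is again `s`.
  set g := s - a * ca.γux s τ with hg_def
  set θ := min (U / 4) (g / (4 * a)) with hθ
  have hθ0 : 0 < θ := by positivity
  have hθ1 : θ ≤ U / 4 := min_le_left _ _
  have hθ2 : a * θ ≤ g / 4 := by
    calc a * θ ≤ a * (g / (4 * a)) := by gcongr; exact min_le_right _ _
      _ = g / 4 := by field_simp
  have hg4 : 0 < g / 4 := by positivity
  obtain ⟨δ₂, hδ₂, h₂⟩ := hP.π₂_K.exists_forall_le hεx
  obtain ⟨δ₃, hδ₃, h₃⟩ := hp.σ₁_K.exists_forall_le (by positivity : 0 < P.α₅ * (P.εx / 8))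
  obtain ⟨δ₄, hδ₄, h₄⟩ := (hA.βu_KL.left 0 le_rfl).exists_forall_le hθ0
  obtain ⟨δ₅, hδ₅, h₅⟩ := hA.γud_K.exists_forall_le hθ0
  obtain ⟨δ₆, hδ₆, h₆⟩ := (hP.βx_KL.left 0 le_rfl).exists_forall_le hg4
  obtain ⟨δ₇, hδ₇, h₇⟩ := (hP.γxd_KL.left τ hτ.le).exists_forall_le hg4
  have hδmin : ∃ δ > 0, δ ≤ δ₁ ∧ δ ≤ δ₂ ∧ δ ≤ δ₃ ∧ δ ≤ δ₄ ∧ δ ≤ δ₅ ∧ δ ≤ δ₆ ∧ δ ≤ δ₇ ∧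
      δ ≤ c ∧ δ ≤ s ∧ δ ≤ P.εw ∧ δ ≤ ca.ε₃ :=
    ⟨min δ₁ (min δ₂ (min δ₃ (min δ₄ (min δ₅ (min δ₆ (min δ₇ (min c (min s (min P.εw ca.ε₃))))))))),
      by positivity, by simp⟩
  obtain ⟨δ, hδ, e₁, e₂, e₃, e₄, e₅, e₆, e₇, ec, es, ew, eε₃⟩ := hδmin
  refine ⟨δ, hδ, fun w hw hd x z he0 hV0 hW0 => ?_⟩
  have hd0 := hw.distNorm_nonneg hτ
  have hdε : distNorm τ w ≤ P.εw := hd.trans ew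
  have hS : P.σ₁ (distNorm τ w) ≤ P.α₅ * (P.εx / 8) := h₃ _ hd0 (hd.trans e₃)
  have hSε : P.εx / 8 < P.εx := by linarith
  have hVnn : ∀ k ξ ζ, 0 ≤ P.V ξ (D.q ζ) (sample τ w k) := fun k ξ ζ =>
    hp.V_nonneg ξ (hreg.q_mem ζ) (hw.sample_mem hτ k)
  have hW0nn : 0 ≤ M.W (z 0) (sample τ w 0) :=
    ha.W_nonneg (hw.sample_mem hτ 0) (hb.mem _ (hw.sample_mem hτ 0)) he0
  suffices H : ∀ K, (∀ k < K, D.ClosedLoopStep τ w x z k) → ∀ k ≤ K,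
      P.V (x k) (D.q (z k)) (sample τ w k) ≤ s ∧ ‖z k - zbar (sample τ w k)‖ ≤ M.ε ∧
        M.W (z k) (sample τ w k) ≤ c from fun K hK k hk => by
    obtain ⟨h1, h2, h3⟩ := H K hK k hk
    exact ⟨h1.trans hsη, h2, h3.trans hcη⟩
  intro K
  induction K with
  | zero =>
    intro _ k hk
    obtain rfl := Nat.le_zero.1 hk
    exact ⟨hV0.trans es, he0, hW0.trans ec⟩
  | succ K ih =>
    intro hstep
    have hbd := ih fun k hk => hstep k (hk.trans (Nat.lt_succ_self K))
    -- input increments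
    obtain ⟨x', z', hT, hx', hz', hV'⟩ :=
      exists_algorithmTraj_extend hp hreg hw hτ hdε hS hSε hstep
    have hV's : ∀ j, P.V (x' j) (D.q (z' j)) (sample τ w j) ≤ s := fun j => by
      rcases le_or_gt j K with hj | hj
      · rw [hx' j hj, hz' j (by omega)]
        exact (hbd j hj).1
      · rw [hV' j hj]
        exact hs0.le
    have hbdd : BddAbove (range fun j => P.V (x' j) (D.q (z' j)) (sample τ w j)) :=
      ⟨s, by rintro _ ⟨j, rfl⟩; exact hV's j⟩
    have hsup : (⨆ j, P.V (x' j) (D.q (z' j)) (sample τ w j)) ≤ s := ciSup_le hV's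
    have hsup0 : 0 ≤ ⨆ j, P.V (x' j) (D.q (z' j)) (sample τ w j) :=
      (hVnn 0 _ _).trans (le_ciSup hbdd 0)
    have hz'0 : z' 0 = z 0 := hz' 0 (by omega)
    have hest := hA.estimate w hw x' z' hT (by rw [hz'0]; exact he0)
      (by rw [hz'0]; exact hW0.trans (ec.trans hcε₁)) hbdd (hsup.trans hsε₂) (hd.trans eε₃)
    have hincr : ∀ j ≤ K, ‖D.q (z (j + 1)) - D.q (z j)‖ ≤ 2 * θ + ca.γux s τ := fun j hj => by
      have h1 := (hest j).2
      rw [hz'0, hz' j (by omega), hz' (j + 1) (by omega)] at h1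
      have h2 := (hA.βu_KL.le_zero_right hW0nn (Nat.cast_nonneg j)).trans
        (h₄ _ hW0nn (hW0.trans e₄))
      have h3 := h₅ _ hd0 (hd.trans e₅)
      have h4 := hKux.mono hsup0 hsup
      linarith
    -- the algorithm state
    obtain ⟨hflow, hzK⟩ := hstep K (Nat.lt_succ_self K)
    obtain ⟨hVK, heK, hWK⟩ := hbd K le_rfl
    -- The one-step lemma is used because it also keeps `z` near the branch; a bound on `W` alone
    -- does not, as `W` is a merit function only locally.
    obtain ⟨heK', hWK'⟩ := Hstep w hw (hd.trans e₁) K (z K) (x K) (x (K + 1)) (hVK.trans hsδ₁)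
      hflow heK (hWK.trans hcc₀)
    rw [← hzK] at heK' hWK'
    replace hWK' := hWK'.trans (max_le (by linarith : M.W (z K) (sample τ w K) - ρ ≤ c) le_rfl)
    -- the plant state
    have hVmid : P.V (x (K + 1)) (D.q (z K)) (sample τ w (K + 1)) ≤ P.εx / 8 := by
      have h1 := hp.V_le_of_flowStep hw hτ hdε hS hSε (hreg.q_mem _) (by linarith) hflow
      have h2 := mul_le_mul_of_nonneg_left (hVK.trans hs8) (Real.exp_pos (-P.α₅ * τ)).le
      linarith
    have hVK1 : P.V (x (K + 1)) (D.q (z (K + 1))) (sample τ w (K + 1)) < P.εx := by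
      have h1 := hlip _ (hw.sample_mem hτ (K + 1)) _ (hreg.q_mem (z K)) _
        (hreg.q_mem (z (K + 1))) (x (K + 1)) (by linarith)
      have h2 : L * ‖D.q (z (K + 1)) - D.q (z K)‖ ≤ L * U := by
        gcongr
        linarith [hincr K le_rfl]
      linarith
    obtain ⟨x'', hT'', hx''⟩ := exists_plantTraj_extend hp hw hτ hdε hS hSε
      (u := fun k => D.q (z k)) (fun k => hreg.q_mem _) (fun k hk => (hstep k hk).1) hVK1
    have hux0 := hKux.nonneg hs0.le
    have hincr'' : incrNorm (fun k => D.q (z (min k (K + 1)))) ≤ 2 * θ + ca.γux s τ := by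
      refine ciSup_le fun j => ?_
      beta_reduce
      rcases le_or_gt j K with hj | hj
      · rw [min_eq_left (by omega : j ≤ K + 1), min_eq_left (by omega : j + 1 ≤ K + 1)]
        exact hincr j hj
      · rw [min_eq_right (by omega : K + 1 ≤ j), min_eq_right (by omega : K + 1 ≤ j + 1), sub_self,
          norm_zero]
        linarith
    have hest'' := hP.estimate w hw _ x'' hT''
      (by
        rw [hx'' 0 (by omega)]
        simp only [Nat.zero_min]
        norm_num
        linarith [hV0.trans es])
      (by linarith) (h₂ _ hd0 (hd.trans e₂)) hdε (K + 1)
    rw [hx'' 0 (by omega), hx'' (K + 1) le_rfl] at hest''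
    simp only [Nat.zero_min, min_self] at hest''
    have hfin : P.V (x (K + 1)) (D.q (z (K + 1))) (sample τ w (K + 1)) ≤ s := by
      have h1 := (hP.βx_KL.le_zero_right (hVnn 0 (x 0) (z 0))
        (natCast_mul_nonneg hτ (K + 1))).trans (h₆ _ (hVnn 0 (x 0) (z 0)) (hV0.trans e₆))
      have h2 := h₇ _ hd0 (hd.trans e₇)
      have h3 := mul_le_mul_of_nonneg_left hincr'' ha0.le
      linarith [mul_add a (2 * θ) (ca.γux s τ), mul_left_comm a 2 θ]
    intro k hk
    rcases Nat.le_succ_iff.1 hk with hk | rfl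
    · exact hbd k hk
    · exact ⟨hfin, heK', hWK'⟩

/-- Along closed-loop trajectories that stay in the region where the gains are valid, a bound `s` on
the Lyapunov function of the plant improves by a fixed amount. -/
theorem exists_closedLoop_contraction (hp : D.PlantAssumption P)
    (hreg : D.RegularityAssumption) (hb : D.IsBranch zbar) (ha : D.AlgorithmAssumption M)
    (hτ : 0 < τ) {cp : PlantGains} {ca : AlgorithmGains} (hP : D.PlantLISS P τ cp)
    (hA : D.AlgorithmLIOS P M zbar τ ca) {s₀ η ρ : ℝ} (hη : 0 < η) (hρ : 0 < ρ)
    (hs₀ : s₀ ≤ min (0.25 * P.εx) ca.ε₂) (hs₀u : ca.γux s₀ τ ≤ cp.π₁ * P.εx / 2)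
    (hgain : ∀ s, η ≤ s → s ≤ s₀ → cp.γxu τ * ca.γux s τ + 2 * ρ ≤ s) :
    ∃ δ > 0, ∃ N : ℕ, ∀ w, D.Admissible w → distNorm τ w ≤ δ → ∀ x z, D.ClosedLoopTraj τ w x z →
      ‖z 0 - zbar (sample τ w 0)‖ ≤ M.ε → M.W (z 0) (sample τ w 0) ≤ ca.ε₁ →
      ∀ s, η ≤ s → s ≤ s₀ → (∀ k, P.V (x k) (D.q (z k)) (sample τ w k) ≤ s) →
      ∀ k ≥ N, P.V (x k) (D.q (z k)) (sample τ w k) ≤ s - ρ := by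
  have hεx := hp.εx_pos
  have hεw := hp.εw_pos
  have hε₃ := hA.ε₃_pos
  have hπ₁ := hP.π₁_pos
  set a := cp.γxu τ with ha_def
  have ha0 : 0 < a := hP.γxu_L.pos hτ.le
  have hKux := hA.γux_KL.left τ hτ.le
  -- The initial transient and the disturbance add at most `2 * θ` to the increments, costing `ρ /
  -- 2` in `V`. With `ρ / 4` each from `βx` and `γxd` the total is `ρ`, half of the gap `2 * ρ`.
  set θ := min (cp.π₁ * P.εx / 4) (ρ / (4 * a)) with hθ
  have hθ0 : 0 < θ := by positivity
  have hθ1 : θ ≤ cp.π₁ * P.εx / 4 := min_le_left _ _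
  have hθ2 : a * θ ≤ ρ / 4 := by
    calc a * θ ≤ a * (ρ / (4 * a)) := by gcongr; exact min_le_right _ _
      _ = ρ / 4 := by field_simp
  obtain ⟨δ₂, hδ₂, h₂⟩ := hP.π₂_K.exists_forall_le hεx
  obtain ⟨δ₅, hδ₅, h₅⟩ := hA.γud_K.exists_forall_le hθ0
  obtain ⟨δ₇, hδ₇, h₇⟩ := (hP.γxd_KL.left τ hτ.le).exists_forall_le (by positivity : 0 < ρ / 4)
  obtain ⟨S₁, hS₁, H₁⟩ := hA.βu_KL.exists_forall_ge ca.ε₁ hθ0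
  obtain ⟨S₂, hS₂, H₂⟩ := hP.βx_KL.exists_forall_ge s₀ (by positivity : 0 < ρ / 4)
  have hδmin : ∃ δ > 0, δ ≤ δ₂ ∧ δ ≤ δ₅ ∧ δ ≤ δ₇ ∧ δ ≤ P.εw ∧ δ ≤ ca.ε₃ :=
    ⟨min δ₂ (min δ₅ (min δ₇ (min P.εw ca.ε₃))), by positivity, by simp⟩
  obtain ⟨δ, hδ, e₂, e₅, e₇, ew, eε₃⟩ := hδmin
  -- After `⌈S₁⌉₊` steps the transient of the increments is below `θ`. The plant estimate is
  -- restarted there on the shifted signal, and `⌈S₂ / τ⌉₊` more steps damp its own transient.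
  refine ⟨δ, hδ, ⌈S₂ / τ⌉₊ + ⌈S₁⌉₊, fun w hw hd x z hT he0 hW0 s hηs hs hV k hk => ?_⟩
  set N := ⌈S₁⌉₊ with hN
  have hVnn : ∀ k, 0 ≤ P.V (x k) (D.q (z k)) (sample τ w k) := fun k =>
    hp.V_nonneg _ (hreg.q_mem _) (hw.sample_mem hτ k)
  have hW0nn : 0 ≤ M.W (z 0) (sample τ w 0) :=
    ha.W_nonneg (hw.sample_mem hτ 0) (hb.mem _ (hw.sample_mem hτ 0)) he0
  have hbdd : BddAbove (range fun j => P.V (x j) (D.q (z j)) (sample τ w j)) :=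
    ⟨s, by rintro _ ⟨j, rfl⟩; exact hV j⟩
  have hsup : (⨆ j, P.V (x j) (D.q (z j)) (sample τ w j)) ≤ s := ciSup_le hV
  have hsup0 : 0 ≤ ⨆ j, P.V (x j) (D.q (z j)) (sample τ w j) := (hVnn 0).trans (le_ciSup hbdd 0)
  have hest := hA.estimate w hw x z hT.algorithmTraj he0 hW0 hbdd
    (hsup.trans (hs.trans (hs₀.trans (min_le_right _ _)))) (hd.trans eε₃)
  have hux0 := hKux.mono hsup0 hsup
  have huxs := hKux.mono (hη.le.trans hηs) hs
  have hincr : ∀ j ≥ N, ‖D.q (z (j + 1)) - D.q (z j)‖ ≤ 2 * θ + ca.γux s τ := fun j hj => by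
    have h1 := (hest j).2
    have h2 := H₁ _ j hW0nn hW0 ((Nat.le_ceil S₁).trans (Nat.cast_le.2 hj))
    have h3 := h₅ _ (hw.distNorm_nonneg hτ) (hd.trans e₅)
    linarith
  have ha' : (0 : ℝ) ≤ N * τ := natCast_mul_nonneg hτ N
  have hw' := hw.shift ha'
  have hd' := (hw.distNorm_shift_le hτ ha').trans hd
  have hd'0 := hw'.distNorm_nonneg hτ
  have hincr' : incrNorm (fun k => D.q (z (k + N))) ≤ 2 * θ + ca.γux s τ := by
    refine ciSup_le fun j => ?_
    beta_reduce
    rw [show j + 1 + N = j + N + 1 by ring]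
    exact hincr _ (Nat.le_add_left _ _)
  have hest' := hP.estimate _ hw' _ _ ((hT.plantTraj hreg.q_mem).shift N)
    (by
      rw [sample_shift]
      exact (hV _).trans (hs.trans (hs₀.trans (min_le_left _ _))))
    (by linarith) (h₂ _ hd'0 (hd'.trans e₂)) (hd'.trans ew) (k - N)
  rw [sample_shift, sample_shift, show k - N + N = k by omega] at hest'
  have hk' : S₂ ≤ ((k - N : ℕ) : ℝ) * τ := by
    rw [← div_le_iff₀ hτ]
    exact (Nat.le_ceil _).trans (Nat.cast_le.2 (by omega))
  have h1 := H₂ _ _ (hVnn (0 + N)) ((hV (0 + N)).trans hs) hk'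
  have h2 := h₇ _ hd'0 (hd'.trans e₇)
  have h3 := mul_le_mul_of_nonneg_left hincr' ha0.le
  have h4 := hgain s hηs hs
  linarith [mul_add a (2 * θ) (ca.γux s τ), mul_left_comm a 2 θ]

/-- Uniform attractivity of the closed loop up to the disturbance. -/
theorem IsBranch.exists_closedLoop_attractivity (hb : D.IsBranch zbar) (hp : D.PlantAssumption P)
    (hreg : D.RegularityAssumption) (ha : D.AlgorithmAssumption M) (hτ : 0 < τ)
    {cp : PlantGains} {ca : AlgorithmGains} (hP : D.PlantLISS P τ cp)
    (hA : D.AlgorithmLIOS P M zbar τ ca)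
    (hgain : ∀ s, 0 < s → s ≤ min (0.25 * P.εx) ca.ε₂ → cp.γxu τ * ca.γux s τ < s) :
    ∃ s₀ > 0, ∀ η > 0, ∃ δ > 0, ∃ N : ℕ, ∀ w, D.Admissible w → distNorm τ w ≤ δ → ∀ x z,
      D.ClosedLoopTraj τ w x z → (∀ k, P.V (x k) (D.q (z k)) (sample τ w k) ≤ s₀ ∧
        ‖z k - zbar (sample τ w k)‖ ≤ M.ε ∧ M.W (z k) (sample τ w k) ≤ s₀) →
      ∀ k ≥ N, P.V (x k) (D.q (z k)) (sample τ w k) ≤ η ∧ M.W (z k) (sample τ w k) ≤ η := by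
  have hεx := hp.εx_pos
  have hε₁ := hA.ε₁_pos
  have hε₂ := hA.ε₂_pos
  have hπ₁ := hP.π₁_pos
  have hKux := hA.γux_KL.left τ hτ.le
  obtain ⟨c, hc, Hmerit⟩ := hb.exists_merit_bounds hp hreg ha hτ
  obtain ⟨sU, hsU, HsU⟩ := hKux.exists_forall_le (by positivity : 0 < cp.π₁ * P.εx / 2)
  have hmin : ∃ s₀ > 0, s₀ ≤ c ∧ s₀ ≤ ca.ε₁ ∧ s₀ ≤ sU ∧ s₀ ≤ 0.25 * P.εx ∧ s₀ ≤ ca.ε₂ :=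
    ⟨min c (min ca.ε₁ (min sU (min (0.25 * P.εx) ca.ε₂))), by positivity, by simp⟩
  obtain ⟨s₀, hs₀, e₁, e₂, e₃, e₄, e₅⟩ := hmin
  have hs₀min : s₀ ≤ min (0.25 * P.εx) ca.ε₂ := le_min e₄ e₅
  refine ⟨s₀, hs₀, fun η₀ hη₀ => ?_⟩
  obtain ⟨δ₁, hδ₁, N₁, Hmerit⟩ := Hmerit η₀ hη₀
  set η := min s₀ (min η₀ δ₁) with hη_def
  have hη : 0 < η := by positivity
  have hηs : η ≤ s₀ := min_le_left _ _
  -- the loop gain is uniformly below one on `[η, s₀]`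
  obtain ⟨ρ, hρ, hρgain⟩ : ∃ ρ > 0, ∀ s, η ≤ s → s ≤ s₀ → cp.γxu τ * ca.γux s τ + 2 * ρ ≤ s := by
    obtain ⟨m, hm, hmin⟩ := isCompact_Icc.exists_isMinOn (nonempty_Icc.2 hηs)
      (f := fun s => s - cp.γxu τ * ca.γux s τ)
      (continuousOn_id.sub (continuousOn_const.mul
        (hKux.continuousOn.mono fun s hs => hη.le.trans hs.1)))
    refine ⟨(m - cp.γxu τ * ca.γux m τ) / 2,
      half_pos (sub_pos.2 (hgain m (hη.trans_le hm.1) (hm.2.trans hs₀min))), fun s h1 h2 => ?_⟩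
    have := isMinOn_iff.1 hmin s ⟨h1, h2⟩
    linarith
  obtain ⟨δ₂, hδ₂, N₂, Hcontr⟩ := exists_closedLoop_contraction hp hreg hb ha hτ hP hA hη hρ hs₀min
    (HsU s₀ hs₀.le e₃) hρgain
  -- Each round of `N₂` steps lowers the bound on `V` by `ρ` until it reaches `η`. Then `V ≤ δ₁`,
  -- and `N₁` further steps bring `W` below `η₀`.
  refine ⟨min δ₁ δ₂, lt_min hδ₁ hδ₂, N₁ + ⌈s₀ / ρ⌉₊ * N₂, fun w hw hd x z hT hbd => ?_⟩
  have hiter : ∀ m : ℕ, ∀ k ≥ m * N₂,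
      P.V (x k) (D.q (z k)) (sample τ w k) ≤ max (s₀ - m * ρ) η := by
    intro m
    induction m with
    | zero => exact fun k _ => le_max_of_le_left (by simpa using (hbd k).1)
    | succ m ih =>
      intro k hk
      rw [Nat.succ_mul] at hk
      set j := m * N₂ with hj
      have ha' : (0 : ℝ) ≤ j * τ := natCast_mul_nonneg hτ j
      have h1 := Hcontr _ (hw.shift ha')
        ((hw.distNorm_shift_le hτ ha').trans (hd.trans (min_le_right _ _))) _ _ (hT.shift j)
        (by rw [sample_shift]; exact (hbd _).2.1)
        (by rw [sample_shift]; exact (hbd _).2.2.trans e₂) (max (s₀ - m * ρ) η)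
        (le_max_right _ _)
        (max_le (by have : 0 ≤ (m : ℝ) * ρ := by positivity
                    linarith) hηs)
        (fun i => by rw [sample_shift]; exact ih _ (Nat.le_add_left _ _)) (k - j) (by omega)
      rw [sample_shift, show k - j + j = k by omega] at h1
      refine h1.trans ?_
      rcases max_cases (s₀ - m * ρ) η with ⟨h, -⟩ | ⟨h, -⟩ <;> rw [h]
      · refine le_max_of_le_left ?_
        push_cast
        linarith
      · exact le_max_of_le_right (by linarith)
  set j := ⌈s₀ / ρ⌉₊ * N₂ with hj
  have hVη : ∀ k ≥ j, P.V (x k) (D.q (z k)) (sample τ w k) ≤ η := fun k hk => by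
    refine (hiter _ k hk).trans (max_le ?_ le_rfl)
    have := (div_le_iff₀ hρ).1 (Nat.le_ceil (s₀ / ρ))
    linarith
  have ha' : (0 : ℝ) ≤ j * τ := natCast_mul_nonneg hτ j
  have hW := (Hmerit _ (hw.shift ha')
    ((hw.distNorm_shift_le hτ ha').trans (hd.trans (min_le_left _ _))) _ _
    (hT.shift j).algorithmTraj
    (fun i => by
      rw [sample_shift]
      exact (hVη _ (Nat.le_add_left _ _)).trans ((min_le_right _ _).trans (min_le_right _ _)))
    (by rw [sample_shift]; exact (hbd _).2.1)
    (by rw [sample_shift]; exact (hbd _).2.2.trans e₁)).2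
  refine fun k hk => ⟨(hVη k (by omega)).trans ((min_le_right _ _).trans (min_le_left _ _)), ?_⟩
  have := hW (k - j) (by omega)
  rwa [sample_shift, show k - j + j = k by omega] at this

/-! ### Error norm -/

theorem exists_errorNorm_le_imp (hp : D.PlantAssumption P) (hreg : D.RegularityAssumption)
    (hb : D.IsBranch zbar) (ha : D.AlgorithmAssumption M) {η : ℝ} (hη : 0 < η) :
    ∃ δ > 0, ∀ ω ∈ D.disturbances, ∀ x z, D.errorNorm zbar x z ω ≤ δ →
      ‖z - zbar ω‖ ≤ M.ε ∧ P.V x (D.q z) ω ≤ η ∧ M.W z ω ≤ η := by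
  have hε := ha.ε_pos
  have hα₄ := hp.α₄_pos
  obtain ⟨δ₁, hδ₁, h₁⟩ := ha.α₂_KInf.toIsClassK.exists_forall_le hη
  refine ⟨min (min M.ε δ₁) √(η / P.α₄), by positivity, fun ω hω x z h => ?_⟩
  have hx : ‖x - D.p (D.q z) ω‖ ≤ D.errorNorm zbar x z ω :=
    Real.le_sqrt_of_sq_le (by nlinarith [sq_nonneg ‖z - zbar ω‖])
  have hz : ‖z - zbar ω‖ ≤ D.errorNorm zbar x z ω :=
    Real.le_sqrt_of_sq_le (by nlinarith [sq_nonneg ‖x - D.p (D.q z) ω‖])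
  have hzε : ‖z - zbar ω‖ ≤ M.ε := hz.trans (h.trans ((min_le_left _ _).trans (min_le_left _ _)))
  refine ⟨hzε, (hp.V_upper x _ (hreg.q_mem z) ω hω).trans ?_,
    (ha.W_upper ω hω _ (hb.mem ω hω) z hzε).trans
      (h₁ _ (norm_nonneg _) (hz.trans (h.trans ((min_le_left _ _).trans (min_le_right _ _)))))⟩
  have h2 : ‖x - D.p (D.q z) ω‖ ^ 2 ≤ η / P.α₄ :=
    (Real.le_sqrt' (by positivity) |>.1 (le_refl √(η / P.α₄))).trans'
      (pow_le_pow_left₀ (norm_nonneg _) (hx.trans (h.trans (min_le_right _ _))) 2)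
  calc _ ≤ P.α₄ * (η / P.α₄) := by gcongr
    _ = η := by field_simp

/-- The quadratic lower bound on `V` and the lower bound `α₁` on `W` control the two error
components. Closeness to the branch must be assumed, since the bound by `α₁` holds only there. -/
theorem exists_imp_errorNorm_le (hp : D.PlantAssumption P) (hreg : D.RegularityAssumption)
    (hb : D.IsBranch zbar) (ha : D.AlgorithmAssumption M) {η : ℝ} (hη : 0 < η) :
    ∃ δ > 0, ∀ ω ∈ D.disturbances, ∀ x z, ‖z - zbar ω‖ ≤ M.ε → P.V x (D.q z) ω ≤ δ →
      M.W z ω ≤ δ → D.errorNorm zbar x z ω ≤ η := by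
  have hα₃ := hp.α₃_pos
  obtain ⟨δ₁, hδ₁, h₁⟩ := ha.norm_error_le (half_pos hη)
  refine ⟨min δ₁ (P.α₃ * (η / 2) ^ 2), by positivity, fun ω hω x z hz hV hW => ?_⟩
  have h1 := h₁ ω hω _ (hb.mem ω hω) z hz (hW.trans (min_le_left _ _))
  have h2 := hp.norm_sub_p_le (hreg.q_mem z) hω (hV.trans (min_le_right _ _))
  rw [mul_div_cancel_left₀ _ hα₃.ne', Real.sqrt_sq (half_pos hη).le] at h2
  refine Real.sqrt_le_iff.2 ⟨hη.le, ?_⟩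
  nlinarith [norm_nonneg (z - zbar ω), norm_nonneg (x - D.p (D.q z) ω)]

/-- Small-gain theorem for the closed loop. -/
theorem IsBranch.closedLoopLISS (hb : D.IsBranch zbar) (hp : D.PlantAssumption P)
    (hreg : D.RegularityAssumption) (ha : D.AlgorithmAssumption M) (hτ : 0 < τ)
    {cp : PlantGains} {ca : AlgorithmGains} (hP : D.PlantLISS P τ cp)
    (hA : D.AlgorithmLIOS P M zbar τ ca)
    (hgain : ∀ s, 0 < s → s ≤ min (0.25 * P.εx) ca.ε₂ → cp.γxu τ * ca.γux s τ < s) :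
    D.ClosedLoopLISS zbar τ := by
  have hεx := hp.εx_pos
  have hεw := hp.εw_pos
  have hα₅ := hp.α₅_pos
  obtain ⟨s₁, hs₁, Hattr⟩ := hb.exists_closedLoop_attractivity hp hreg ha hτ hP hA hgain
  obtain ⟨s₂, hs₂, Hone⟩ := exists_imp_errorNorm_le hp hreg hb ha one_pos
  set s₀ := min (P.εx / 2) (min s₁ s₂) with hs₀
  have hs₀pos : 0 < s₀ := by positivity
  have hs₀₁ : s₀ ≤ s₁ := (min_le_right _ _).trans (min_le_left _ _)
  have hs₀₂ : s₀ ≤ s₂ := (min_le_right _ _).trans (min_le_right _ _)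
  have hs₀x : s₀ < P.εx := (min_le_left _ _).trans_lt (by linarith)
  have Hstab := fun η (hη : (0 : ℝ) < η) =>
    hb.exists_closedLoop_bounds hp hreg ha hτ hP hA hgain hη
  obtain ⟨δ₁, hδ₁, H₁⟩ := Hstab s₀ hs₀pos
  obtain ⟨δ₂, hδ₂, H₂⟩ := exists_errorNorm_le_imp hp hreg hb ha hδ₁
  obtain ⟨δ₃, hδ₃, H₃⟩ := hp.σ₁_K.exists_forall_le (by positivity : 0 < P.α₅ * (P.εx / 2))
  have hmin : ∃ ε > 0, ε ≤ δ₁ ∧ ε ≤ δ₂ ∧ ε ≤ δ₃ ∧ ε ≤ P.εw :=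
    ⟨min δ₁ (min δ₂ (min δ₃ P.εw)), by positivity, by simp⟩
  obtain ⟨ε, hε, e₁, e₂, e₃, ew⟩ := hmin
  let good : (ℝ → Euc nw) × (ℕ → Euc nx) × (ℕ → Euc nz) → Prop := fun a =>
    D.Admissible a.1 ∧ distNorm τ a.1 ≤ ε ∧
      D.errorNorm zbar (a.2.1 0) (a.2.2 0) (sample τ a.1 0) ≤ ε ∧ D.ClosedLoopTraj τ a.1 a.2.1 a.2.2
  let e : {a // good a} → ℕ → ℝ := fun a k =>
    D.errorNorm zbar (a.1.2.1 k) (a.1.2.2 k) (sample τ a.1.1 k)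
  have hinv : ∀ a : {a // good a}, ∀ k,
      P.V (a.1.2.1 k) (D.q (a.1.2.2 k)) (sample τ a.1.1 k) ≤ s₀ ∧
      ‖a.1.2.2 k - zbar (sample τ a.1.1 k)‖ ≤ M.ε ∧ M.W (a.1.2.2 k) (sample τ a.1.1 k) ≤ s₀ :=
    fun a k => by
      obtain ⟨hw, hd, he, hT⟩ := a.2
      obtain ⟨h1, h2, h3⟩ := H₂ _ (hw.sample_mem hτ 0) _ _ (he.trans e₂)
      exact H₁ _ hw (hd.trans e₁) _ _ h1 h2 h3 k (fun j _ => hT j) k le_rfl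
  obtain ⟨β, hβ, γ, hγ, Hβ⟩ := exists_classKL_estimate (fun a => e a 0)
    (fun a : {a // good a} => distNorm τ a.1.1) e 1 (fun a => Real.sqrt_nonneg _)
    (fun a => a.2.1.distNorm_nonneg hτ)
    (fun a k => by
      obtain ⟨h1, h2, h3⟩ := hinv a k
      exact Hone _ (a.2.1.sample_mem hτ k) _ _ h2 (h1.trans hs₀₂) (h3.trans hs₀₂))
    (fun η hη => by
      obtain ⟨κ, hκ, h₁⟩ := exists_imp_errorNorm_le hp hreg hb ha hη
      obtain ⟨δ, hδ, h₂⟩ := Hstab κ hκ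
      obtain ⟨δ', hδ', h₃⟩ := exists_errorNorm_le_imp hp hreg hb ha hδ
      refine ⟨min δ δ', lt_min hδ hδ', fun a hr hd k => ?_⟩
      obtain ⟨g1, g2, g3⟩ := h₃ _ (a.2.1.sample_mem hτ 0) _ _ (hr.trans (min_le_right _ _))
      obtain ⟨g4, g5, g6⟩ := h₂ _ a.2.1 (hd.trans (min_le_left _ _)) _ _ g1 g2 g3 k
        (fun j _ => a.2.2.2.2 j) k le_rfl
      exact h₁ _ (a.2.1.sample_mem hτ k) _ _ g5 g4 g6)
    (fun η hη => by
      obtain ⟨κ, hκ, h₁⟩ := exists_imp_errorNorm_le hp hreg hb ha hη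
      obtain ⟨δ, hδ, N, h₂⟩ := Hattr κ hκ
      refine ⟨δ, hδ, N, fun a hd k hk => ?_⟩
      obtain ⟨g1, g2⟩ := h₂ _ a.2.1 hd _ _ a.2.2.2.2
        (fun k => ⟨(hinv a k).1.trans hs₀₁, (hinv a k).2.1, (hinv a k).2.2.trans hs₀₁⟩) k hk
      exact h₁ _ (a.2.1.sample_mem hτ k) _ _ (hinv a k).2.1 g1 g2)
  refine ⟨ε, hε, β, hβ, γ, hγ, fun w hw hd x₀ z₀ he => ⟨?_, ?_⟩⟩
  · obtain ⟨h1, h2, h3⟩ := H₂ _ (hw.sample_mem hτ 0) _ _ (he.trans e₂)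
    -- Stability of finite pieces gives `V ≤ s₀ < εx` at the last point reached, so the flow exists
    -- for one more period.
    obtain ⟨a, ha0, haR⟩ := exists_seq_of_forall_partial
      (fun k (s s' : Euc nx × Euc nz) => D.FlowStep τ w k (D.q s.2) s.1 s'.1 ∧
        s'.2 = D.T s.2 (D.g s'.1 (sample τ w (k + 1)))) (x₀, z₀) (fun K a ha0 haR => by
          obtain ⟨hV, -, -⟩ := H₁ w hw (hd.trans e₁) (fun k => (a k).1) (fun k => (a k).2)
            (by simpa only [ha0] using h1) (by simpa only [ha0] using h2)
            (by simpa only [ha0] using h3) K haR K le_rfl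
          obtain ⟨ξ, hξ⟩ := hp.exists_flowStep hw hτ (hd.trans ew)
            (H₃ _ (hw.distNorm_nonneg hτ) (hd.trans e₃)) (by linarith) (hreg.q_mem (a K).2) K
            (hV.trans_lt hs₀x)
          exact ⟨(ξ, D.T (a K).2 (D.g ξ (sample τ w (K + 1)))), hξ, rfl⟩)
    exact ⟨fun k => (a k).1, fun k => (a k).2, by simp only [ha0], by simp only [ha0], haR⟩
  · rintro x z rfl rfl hT k
    exact Hβ ⟨(w, x, z), hw, hd, he, hT⟩ k

end FESData

theorem mainTheorem2 {nx nu nw ny nz : ℕ} (D : FESData nx nu nw ny nz)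
    (P : PlantLyapunov nx nu nw) (M : AlgorithmMerit nw nz)
    (hplant : D.PlantAssumption P) (hreg : D.RegularityAssumption)
    (halg : D.AlgorithmAssumption M)
    (zbar : Euc nw → Euc nz) (hbranch : D.IsBranch zbar) (τ : ℝ) (hτ : 0 < τ) :
    ((∃ c : PlantGains, D.PlantLISS P τ c) ∧
      (∃ c : AlgorithmGains, D.AlgorithmLIOS P M zbar τ c)) ∧
    ∀ (cp : PlantGains) (ca : AlgorithmGains),
      D.PlantLISS P τ cp → D.AlgorithmLIOS P M zbar τ ca →
      (∀ s, 0 < s → s ≤ min (0.25 * P.εx) ca.ε₂ → cp.γxu τ * ca.γux s τ < s) →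
      D.ClosedLoopLISS zbar τ :=
  ⟨⟨hplant.exists_plantLISS hτ, hbranch.exists_algorithmLIOS hplant hreg halg hτ⟩,
    fun _ _ hP hA hgain => hbranch.closedLoopLISS hplant hreg halg hτ hP hA hgain⟩
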